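/- Let $G=(V,E)$ be a finite simple graph with $V\ne\emptyset$. A set $E'\subseteq E$ is a pathset if the spanning subgraph $(V,E')$ is connected. $G$ is \emph{separable} if there are costs $c_e\ge 0$ ($e\in E$) and a threshold $\alpha\in\mathbb R$ such that, for every $E'\subseteq E$, $\sum_{e\in E'}c_e\ge\alpha$ if and only if $(V,E')$ is connected. If the links $e\in E$ operate independently with probabilities $p_e\in[0,1]$, the \emph{all-terminal reliability} is $$R(G)=\sum_{E'\subseteq E,\ (V,E')\text{ connected}}\ \prod_{e\in E'}p_e\prod_{e\in E\setminus E'}(1-p_e).$$ An \emph{elementary cycle with arborescences} is a graph consisting of an elementary cycle $C$ together with at least one further link, such that the links outside $C$ form a forest $T$ and every node of $G$ lies in the component, in $(V,T)$, of exactly one node of $C$ (trees hanging from the nodes of the cycle). For a set $C$ of links put $$\Phi(C)=\prod_{e\in C}p_e+\sum_{e\in C}(1-p_e)\prod_{e'\in C\setminus\{e\}}p_{e'} .$$ (a) Every separable graph $G$ is disconnected, a tree, an elementary cycle, or an elementary cycle with arborescences, and, for all link reliabilities $p_e\in[0,1]$: \begin{enumerate} \item if $G$ is not connected, then $R(G)=0$;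 \item if $G$ is a tree, then $R(G)=\prod_{e\in E}p_e$; \item if $G$ is an elementary cycle, then $R(G)=\Phi(E)$; \item if $G$ is an elementary cycle $C$ with arborescences, $T$ being the set of links outside $C$, then $R(G)=\Phi(C)\cdot\prod_{e\in T}p_e$. \end{enumerate} (b) The all-terminal reliability of separable graphs with rational link reliabilities can be computed in polynomial time. More precisely, there is a single random access machine program (with addition, truncated subtraction, multiplication and comparison of natural numbers, indirect addressing, and structured control flow) which, given the number $n\ge1$ of nodes, the number $m$ of links, and the list of the $m$ links of a separable graph $G$ with their reliabilities as quotients of natural numbers, halts with natural numbers $x$ and $y>0$ such that $R(G)=x/y$; its running time under the logarithmic (bit) cost measure is bounded by a polynomial in the number of binary digits of the input, and it performs $O((m+1)^2)$ elementary operations, and only $O(m+1)$ elementary operations if $G$ is disconnected or a tree. -/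

import Mathlib

/-! ## Separable graphs and all-terminal reliability -/

namespace SepRel

section Graphs

variable {V : Type*} [Finite V]

/-- The finite set of links of a simple graph on a finite node set. -/
noncomputable def links (G : SimpleGraph V) : Finset (Sym2 V) :=
  (Set.toFinite G.edgeSet).toFinset

/-- The spanning subgraph with node set `V` and link set `E` is connected, i.e. the set `E` of
operational links is a pathset. -/
def IsPathset (E : Finset (Sym2 V)) : Prop :=
  (SimpleGraph.fromEdgeSet (E : Set (Sym2 V))).Connected

/-- `G` is separable: there are non-negative link costs and a threshold `α` such that a set of links
has cost at least `α` iff the spanning subgraph with these links is connected. -/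
def IsSeparable (G : SimpleGraph V) : Prop :=
  ∃ (c : Sym2 V → ℝ) (α : ℝ), (∀ e ∈ links G, 0 ≤ c e) ∧
    ∀ E ⊆ links G, α ≤ ∑ e ∈ E, c e ↔ IsPathset E

open scoped Classical in
/-- All-terminal reliability: the links work independently, the link `e` with probability `p e`, and
the reliability is the total probability of the states in which the operational links connect all
nodes. -/
noncomputable def reliability (G : SimpleGraph V) (p : Sym2 V → ℝ) : ℝ :=
  ∑ E ∈ (links G).powerset with IsPathset E,
    (∏ e ∈ E, p e) * ∏ e ∈ links G \ E, (1 - p e)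

open scoped Classical in
/-- The probability that all links of `C` work, or exactly one of them is down. -/
noncomputable def cycleTerm (C : Finset (Sym2 V)) (p : Sym2 V → ℝ) : ℝ :=
  ∏ e ∈ C, p e + ∑ e ∈ C, (1 - p e) * ∏ e' ∈ C.erase e, p e'

/-- `G` is an elementary cycle: some cycle of `G` visits all nodes and uses all links. -/
def IsElementaryCycle (G : SimpleGraph V) : Prop :=
  ∃ (u : V) (c : G.Walk u u), c.IsCycle ∧ (∀ v, v ∈ c.support) ∧ ∀ e ∈ G.edgeSet, e ∈ c.edges

/-- What is left of `G` when the links of the closed walk `c` are deleted (all nodes are kept). -/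
def pendantPart (G : SimpleGraph V) {u : V} (c : G.Walk u u) : SimpleGraph V :=
  G.deleteEdges {e | e ∈ c.edges}

/-- `G` consists of the elementary cycle `c` and of at least one link outside it, where the links
outside `c` form trees that hang from the nodes of `c`: they form a forest, and each node of `G` lies
in the tree of exactly one node of `c`. -/
def IsCycleWithArborescences (G : SimpleGraph V) {u : V} (c : G.Walk u u) : Prop :=
  c.IsCycle ∧ pendantPart G c ≠ ⊥ ∧ (pendantPart G c).IsAcyclic ∧
    ∀ v, ∃! x, x ∈ c.support ∧ (pendantPart G c).Reachable v x

open scoped Classical in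
/-- The finite set of links of a walk. -/
noncomputable def walkLinks {G : SimpleGraph V} {u : V} (c : G.Walk u u) : Finset (Sym2 V) :=
  c.edges.toFinset

end Graphs

/-! ## Random access machines with unit and logarithmic cost -/

/-- The binary operations of the machine on natural numbers; subtraction is truncated. -/
inductive Op
  | add | sub | mul

def Op.eval : Op → ℕ → ℕ → ℕ
  | .add, a, b => a + b
  | .sub, a, b => a - b
  | .mul, a, b => a * b

/-- Comparisons of the contents of two registers. -/
inductive Test
  | lt (x y : ℕ)
  | eq (x y : ℕ)

/-- Programs of the machine. Registers `x, y, z` and arrays `a` are named by numerals, so each program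
uses finitely many of them. -/
inductive Prog
  | skip
  /-- `x := k` -/
  | const (x k : ℕ)
  /-- `x := y o z` -/
  | arith (o : Op) (x y z : ℕ)
  /-- `x := a[i]`, where the index is the content of the register `i` -/
  | load (x a i : ℕ)
  /-- `a[i] := y`, where the index is the content of the register `i` -/
  | store (a i y : ℕ)
  | seq (P Q : Prog)
  | ite (b : Test) (P Q : Prog)
  | while (b : Test) (P : Prog)

/-- Contents of the registers and of the arrays. -/
structure State where
  reg : ℕ → ℕ
  arr : ℕ → ℕ → ℕ

namespace State

def setReg (s : State) (x v : ℕ) : State :=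
  { s with reg := Function.update s.reg x v }

def setArr (s : State) (a i v : ℕ) : State :=
  { s with arr := Function.update s.arr a (Function.update (s.arr a) i v) }

end State

def Test.holds (s : State) : Test → Prop
  | .lt x y => s.reg x < s.reg y
  | .eq x y => s.reg x = s.reg y

/-- Logarithmic cost of a comparison. -/
def Test.cost (s : State) : Test → ℕ
  | .lt x y => 1 + (s.reg x).size + (s.reg y).size
  | .eq x y => 1 + (s.reg x).size + (s.reg y).size

/-- `Runs P s s' t b`: the program `P`, started in the state `s`, halts in the state `s'` after `t`
elementary operations (instructions and comparisons), whose total logarithmic cost is `b`. The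
logarithmic cost of an operation is one more than the total number of binary digits of its operands,
of its array index, and of its result. -/
inductive Runs : Prog → State → State → ℕ → ℕ → Prop
  | skip (s : State) : Runs .skip s s 1 1
  | const (s : State) (x k : ℕ) : Runs (.const x k) s (s.setReg x k) 1 (1 + k.size)
  | arith (s : State) (o : Op) (x y z : ℕ) :
      Runs (.arith o x y z) s (s.setReg x (o.eval (s.reg y) (s.reg z))) 1
        (1 + (s.reg y).size + (s.reg z).size + (o.eval (s.reg y) (s.reg z)).size)
  | load (s : State) (x a i : ℕ) :
      Runs (.load x a i) s (s.setReg x (s.arr a (s.reg i))) 1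
        (1 + (s.reg i).size + (s.arr a (s.reg i)).size)
  | store (s : State) (a i y : ℕ) :
      Runs (.store a i y) s (s.setArr a (s.reg i) (s.reg y)) 1
        (1 + (s.reg i).size + (s.reg y).size)
  | seq {P Q : Prog} {s s' s'' : State} {t b t' b' : ℕ} :
      Runs P s s' t b → Runs Q s' s'' t' b' → Runs (.seq P Q) s s'' (t + t') (b + b')
  | ite_true {β : Test} {P Q : Prog} {s s' : State} {t b : ℕ} :
      β.holds s → Runs P s s' t b → Runs (.ite β P Q) s s' (1 + t) (β.cost s + b)
  | ite_false {β : Test} {P Q : Prog} {s s' : State} {t b : ℕ} :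
      ¬ β.holds s → Runs Q s s' t b → Runs (.ite β P Q) s s' (1 + t) (β.cost s + b)
  | while_true {β : Test} {P : Prog} {s s' s'' : State} {t b t' b' : ℕ} :
      β.holds s → Runs P s s' t b → Runs (.while β P) s' s'' t' b' →
        Runs (.while β P) s s'' (1 + t + t') (β.cost s + b + b')
  | while_false {β : Test} {P : Prog} {s : State} :
      ¬ β.holds s → Runs (.while β P) s s 1 (β.cost s)

/-! ## Instances of the reliability problem -/

/-- A simple graph with nodes `0, …, n - 1` and with a list of its `m` links, each link with a rational
reliability `num / den` in `[0, 1]`. -/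
structure Network where
  n : ℕ
  m : ℕ
  n_pos : 0 < n
  src : Fin m → Fin n
  tgt : Fin m → Fin n
  src_ne_tgt : ∀ i, src i ≠ tgt i
  link_injective : Function.Injective fun i => s(src i, tgt i)
  num : Fin m → ℕ
  den : Fin m → ℕ
  den_pos : ∀ i, 0 < den i
  num_le_den : ∀ i, num i ≤ den i

namespace Network

/-- The underlying graph. -/
def graph (N : Network) : SimpleGraph (Fin N.n) :=
  SimpleGraph.fromEdgeSet (Set.range fun i => s(N.src i, N.tgt i))

open scoped Classical in
/-- The link reliabilities: `num i / den i` on the `i`-th link (and `0` off the links). -/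
noncomputable def prob (N : Network) (e : Sym2 (Fin N.n)) : ℝ :=
  ∑ i with s(N.src i, N.tgt i) = e, (N.num i : ℝ) / N.den i

/-- Total number of binary digits of the input. -/
def bitSize (N : Network) : ℕ :=
  N.n.size + N.m.size +
    ∑ i, ((N.src i : ℕ).size + (N.tgt i : ℕ).size + (N.num i).size + (N.den i).size)

/-- The state in which the machine is started: `n` and `m` are in the registers `0` and `1`, the two
ends, the numerators and the denominators of the links are in the arrays `0`, `1`, `2`, `3`, and
everything else is `0`. -/
def input (N : Network) : State where
  reg x := match x with
    | 0 => N.n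
    | 1 => N.m
    | _ => 0
  arr a i :=
    if h : i < N.m then
      match a with
      | 0 => N.src ⟨i, h⟩
      | 1 => N.tgt ⟨i, h⟩
      | 2 => N.num ⟨i, h⟩
      | 3 => N.den ⟨i, h⟩
      | _ => 0
    else 0

end Network

/-- The machine outputs the number `r`, as a quotient of the integers in the registers `0` and `1`. -/
def State.Outputs (s : State) (r : ℝ) : Prop :=
  0 < s.reg 1 ∧ r = (s.reg 0 : ℝ) / s.reg 1

end SepRel

namespace SepRel

/-! ### Pathsets, exchange along cycles, and asummability -/

section Graphs

variable {V : Type*}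

open SimpleGraph

/-! The structural half rests on one exchange argument (`IsSeparable.asummable`). Let `H` be a set
of links of a separable graph. If `H - {a,b}` and `H - {c,d}` are connected while `H - {a,c}` and `H
- {b,d}` are not, then summing costs over each pair of sets gives the same total, which is at once
at least `2α` and less than `2α`.

Let `T` be a spanning tree of a connected separable graph and suppose that two links `e ≠ f` lie
outside `T`, with tree paths `p` and `q` between their ends. Take `H = T + e + f`. If there are `s`
on `p` but not on `q` and `t` on `q` but not on `p`, the pairs `{e,f}` and `{s,t}` can be removed,
but `{e,s}` and `{f,t}` cannot. If `p` is strictly contained in `q`, take `t` on `q` but not on `p`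
and two consecutive links `d₁, d₂` of `p`: the pairs `{d₁,f}` and `{d₂,t}` can be removed, but
`{d₁,d₂}` and `{f,t}` cannot. If `p` and `q` have the same links, then `e` and `f` have the same
ends, so they coincide. Hence the graph is a tree or a tree plus one link, and in the latter case a
cycle with possibly empty trees hanging from it.

A connected graph with at most as many links as nodes stays connected only if at most one link
fails. So the reliability is the product of all `p e` plus the contributions of those single links
whose failure is harmless, which are exactly the links on the cycle (`reliability_eq_of_card_le`,
`isPathset_erase_iff_of_hanging`).

The program needs no cycle detection. It returns `0` unless `n - 1 ≤ m ≤ n` and a breadth-first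
search reaches every node. Otherwise it multiplies the numerators and, only if `m = n`, repeats the
search with each link left out in turn and adds the corresponding product. All numbers that occur
have at most `L = bitSize + 2` digits, so each operation costs at most `3L + 1`, and the bit cost
follows from the operation count. -/

theorem not_adj_two_of_isPath {G : SimpleGraph V} {w y a b : V} {p : G.Walk w y} (hp : p.IsPath)
    (ha : s(w, a) ∈ p.edges) (hb : s(w, b) ∈ p.edges) : a = b := by
  cases p with
  | nil => simp at ha
  | cons h p' =>
    rw [Walk.cons_isPath_iff] at hp
    rename_i w'
    have key : ∀ c, s(w, c) ∈ (Walk.cons h p').edges → s(w, c) = s(w, w') := by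
      intro c hc
      rw [Walk.edges_cons, List.mem_cons] at hc
      rcases hc with hc | hc
      · exact hc
      · exact absurd (Walk.fst_mem_support_of_mem_edges _ hc) hp.2
    have := (key a ha).trans (key b hb).symm
    exact Sym2.congr_right.1 this

theorem mem_of_reachable {G : SimpleGraph V} {S : Set V} (hS : ∀ a b, G.Adj a b → a ∈ S → b ∈ S)
    {a b : V} (h : G.Reachable a b) (ha : a ∈ S) : b ∈ S := by
  obtain ⟨p⟩ := h
  induction p with
  | nil => exact ha
  | cons hadj _ ih => exact ih (hS _ _ hadj ha)

theorem reachable_of_edges_subset {G : SimpleGraph V} {E : Set (Sym2 V)} {u v : V} (p : G.Walk u v)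
    (h : ∀ e ∈ p.edges, e ∈ E) : (fromEdgeSet E).Reachable u v :=
  ⟨p.transfer _ fun e he => by
    rw [edgeSet_fromEdgeSet]
    exact ⟨h e he, G.not_isDiag_of_mem_edgeSet (p.edges_subset_edgeSet he)⟩⟩

theorem deleteEdges_singleton_eq [DecidableEq V] {G : SimpleGraph V} {E : Finset (Sym2 V)}
    (h : fromEdgeSet (E : Set (Sym2 V)) = G) (e : Sym2 V) :
    G.deleteEdges {e} = fromEdgeSet ((E.erase e : Finset (Sym2 V)) : Set (Sym2 V)) := by
  subst h
  ext a b
  simp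

theorem IsPathset.mono {E F : Finset (Sym2 V)} (hE : IsPathset E) (h : E ⊆ F) : IsPathset F :=
  SimpleGraph.Connected.mono (fromEdgeSet_mono (by exact_mod_cast h)) hE

/-- Removing a link of a cycle keeps a pathset connected. -/
theorem IsPathset.erase_of_mem_isCycle [DecidableEq V] {G : SimpleGraph V} {F : Finset (Sym2 V)}
    (hF : IsPathset F) {u : V} {c : G.Walk u u} (hc : c.IsCycle) (hcF : ∀ e ∈ c.edges, e ∈ F)
    {t : Sym2 V} (ht : t ∈ c.edges) : IsPathset (F.erase t) := by
  have htr : ∀ e ∈ c.edges, e ∈ (fromEdgeSet (F : Set (Sym2 V))).edgeSet := fun e he => by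
    rw [edgeSet_fromEdgeSet]
    exact ⟨hcF e he, G.not_isDiag_of_mem_edgeSet (c.edges_subset_edgeSet he)⟩
  have hcyc := hc.transfer htr
  have hnb : ¬ (fromEdgeSet (F : Set (Sym2 V))).IsBridge t := fun hb =>
    hb.notMem_edges_of_isCycle hcyc (by rwa [Walk.edges_transfer])
  induction t with | h a b =>
  have := Connected.connected_delete_edge_of_not_isBridge hF hnb
  rwa [deleteEdges_singleton_eq rfl] at this

/-- The link `s(u, v)` closes `p` to a cycle through `t`. This is how a link outside a tree replaces
a link of its tree path. -/
theorem IsPathset.erase_of_mem_isPath [DecidableEq V] {T : SimpleGraph V} {F : Finset (Sym2 V)}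
    (hF : IsPathset F) {u v : V} (huv : u ≠ v) {p : T.Walk u v} (hp : p.IsPath)
    (hpF : ∀ e ∈ p.edges, e ∈ F) (he : s(u, v) ∈ F) (hep : s(u, v) ∉ p.edges) {t : Sym2 V}
    (ht : t ∈ p.edges) : IsPathset (F.erase t) := by
  have htr : ∀ e ∈ p.edges, e ∈ (fromEdgeSet (F : Set (Sym2 V))).edgeSet := fun e he => by
    rw [edgeSet_fromEdgeSet]
    exact ⟨hpF e he, T.not_isDiag_of_mem_edgeSet (p.edges_subset_edgeSet he)⟩
  have hadj : (fromEdgeSet (F : Set (Sym2 V))).Adj v u := by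
    rw [fromEdgeSet_adj]
    exact ⟨by rw [Sym2.eq_swap]; exact he, huv.symm⟩
  refine hF.erase_of_mem_isCycle (c := Walk.cons hadj (p.transfer _ htr)) ?_ ?_ ?_
  · rw [Walk.cons_isCycle_iff]
    refine ⟨hp.transfer htr, ?_⟩
    rw [Walk.edges_transfer, Sym2.eq_swap]
    exact hep
  · intro e
    simp only [Walk.edges_cons, Walk.edges_transfer, List.mem_cons]
    rintro (rfl | h)
    · rw [Sym2.eq_swap]; exact he
    · exact hpF _ h
  · simp [ht]

/-- Each passage of a walk through the inserted link can be replaced by a detour inside `F`. -/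
theorem IsPathset.of_insert [DecidableEq V] {F : Finset (Sym2 V)} {x y : V}
    (h : IsPathset (insert s(x, y) F))
    (hr : (fromEdgeSet (F : Set (Sym2 V))).Reachable x y) : IsPathset F := by
  have := h.nonempty
  refine ⟨fun a b => ?_⟩
  obtain ⟨w⟩ := h.preconnected a b
  induction w with
  | nil => exact Reachable.refl _
  | cons hadj _ ih =>
    refine Reachable.trans ?_ ih
    rw [fromEdgeSet_adj] at hadj
    obtain ⟨h1, h2⟩ := hadj
    simp only [Finset.coe_insert, Set.mem_insert_iff, Finset.mem_coe] at h1
    rcases h1 with h1 | h1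
    · rw [Sym2.eq_iff] at h1
      rcases h1 with ⟨rfl, rfl⟩ | ⟨rfl, rfl⟩
      · exact hr
      · exact hr.symm
    · exact Adj.reachable (by rw [fromEdgeSet_adj]; exact ⟨h1, h2⟩)

variable [Finite V]

@[simp] theorem mem_links {G : SimpleGraph V} {e : Sym2 V} : e ∈ links G ↔ e ∈ G.edgeSet := by
  simp [links]

@[simp] theorem fromEdgeSet_links (G : SimpleGraph V) :
    fromEdgeSet (links G : Set (Sym2 V)) = G := by
  simp [links]

theorem isPathset_links {G : SimpleGraph V} : IsPathset (links G) ↔ G.Connected := by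
  rw [IsPathset, fromEdgeSet_links]

theorem links_mono {G H : SimpleGraph V} (h : G ≤ H) : links G ⊆ links H := fun e he => by
  rw [mem_links] at *
  exact edgeSet_mono h he

theorem card_links (G : SimpleGraph V) : (links G).card = Nat.card G.edgeSet := by
  rw [links, ← Set.ncard_eq_toFinset_card, Nat.card_coe_set_eq]

theorem not_reachable_erase_of_isAcyclic [DecidableEq V] {T : SimpleGraph V} (hT : T.IsAcyclic)
    {a b : V} (h : s(a, b) ∈ links T) :
    ¬ (fromEdgeSet (((links T).erase s(a, b) : Finset (Sym2 V)) : Set (Sym2 V))).Reachable a b := by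
  rw [← deleteEdges_singleton_eq (fromEdgeSet_links T), ← isBridge_iff]
  exact isAcyclic_iff_forall_isBridge.1 hT (mem_links.1 h)

theorem not_isPathset_erase_of_isAcyclic [DecidableEq V] {T : SimpleGraph V} (hT : T.IsAcyclic)
    {t : Sym2 V} (h : t ∈ links T) : ¬ IsPathset ((links T).erase t) := by
  induction t with | h a b =>
  exact fun hc => not_reachable_erase_of_isAcyclic hT h (hc.preconnected a b)

/-- Threshold functions are 2-asummable. -/
theorem IsSeparable.asummable [DecidableEq V] {G : SimpleGraph V} (hG : IsSeparable G)
    {H : Finset (Sym2 V)} (hH : H ⊆ links G) {a b c d : Sym2 V}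
    (ha : a ∈ H) (hb : b ∈ H) (hc : c ∈ H) (hd : d ∈ H)
    (hab : a ≠ b) (hcd : c ≠ d) (hac : a ≠ c) (hbd : b ≠ d)
    (h1 : IsPathset ((H.erase a).erase b)) (h2 : IsPathset ((H.erase c).erase d))
    (h3 : ¬ IsPathset ((H.erase a).erase c)) (h4 : ¬ IsPathset ((H.erase b).erase d)) : False := by
  obtain ⟨k, α, -, hk⟩ := hG
  have hsub : ∀ x y, (H.erase x).erase y ⊆ links G := fun x y =>
    ((Finset.erase_subset _ _).trans (Finset.erase_subset _ _)).trans hH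
  have hsum : ∀ x y, x ∈ H → y ∈ H → x ≠ y →
      ∑ e ∈ (H.erase x).erase y, k e = ∑ e ∈ H, k e - k x - k y := by
    intro x y hx hy hxy
    rw [Finset.sum_erase_eq_sub (Finset.mem_erase.2 ⟨hxy.symm, hy⟩), Finset.sum_erase_eq_sub hx]
  -- With total cost `K` of `H`, the sums `k a + k b` and `k c + k d` are at most `K - α`, while `k
  -- a + k c` and `k b + k d` exceed it.
  rw [← hk _ (hsub _ _), hsum _ _ ‹_› ‹_› ‹_›] at h1 h2 h3 h4
  linarith

/-- The middle node of two consecutive links of a path of a tree is cut off when these links are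
deleted, even if two links are added whose tree paths contain both of them. -/
theorem not_isPathset_of_two_consecutive [DecidableEq V] {T : SimpleGraph V} (hT : T.IsTree)
    {u v w z x y : V} (h1 : T.Adj u w) (h2 : T.Adj w z) (p : T.Walk z v)
    (hp : (Walk.cons h1 (Walk.cons h2 p)).IsPath) {q : T.Walk x y} (hq : q.IsPath)
    (hq1 : s(u, w) ∈ q.edges) (hq2 : s(w, z) ∈ q.edges) :
    ¬ IsPathset (((insert s(u, v) (insert s(x, y) (links T))).erase s(u, w)).erase s(w, z)) := by
  have huz : u ≠ z := by
    rintro rfl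
    simp [Walk.cons_isPath_iff] at hp
  set F := ((links T).erase s(u, w)).erase s(w, z) with hF
  have huw' : s(u, w) ∈ links T := by simpa using h1
  have hwz' : s(w, z) ∈ links T := by simpa using h2
  have hF1 : fromEdgeSet (F : Set (Sym2 V)) ≤
      fromEdgeSet (((links T).erase s(u, w) : Finset (Sym2 V)) : Set (Sym2 V)) :=
    fromEdgeSet_mono (by exact_mod_cast Finset.erase_subset _ _)
  have hF2 : fromEdgeSet (F : Set (Sym2 V)) ≤
      fromEdgeSet (((links T).erase s(w, z) : Finset (Sym2 V)) : Set (Sym2 V)) :=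
    fromEdgeSet_mono (by
      rw [hF, Finset.erase_right_comm]
      exact_mod_cast Finset.erase_subset _ _)
  have hFT : fromEdgeSet (F : Set (Sym2 V)) ≤ T := by
    conv_rhs => rw [← fromEdgeSet_links T]
    exact fromEdgeSet_mono (by
      exact_mod_cast (Finset.erase_subset _ _).trans (Finset.erase_subset _ _))
  have hu : ¬ (fromEdgeSet (F : Set (Sym2 V))).Reachable w u := fun h =>
    not_reachable_erase_of_isAcyclic hT.isAcyclic huw' (h.symm.mono hF1)
  -- The rest `p` of the path joins `z` to `v` without `s(w, z)`, so a connection from `w` to `v` in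
  -- `F` would bypass this bridge of `T`.
  have hv : ¬ (fromEdgeSet (F : Set (Sym2 V))).Reachable w v := fun h => by
    refine not_reachable_erase_of_isAcyclic hT.isAcyclic hwz' ((h.mono hF2).trans ?_)
    refine (reachable_of_edges_subset p fun e he => ?_).symm
    have := hp.isTrail.edges_nodup
    simp only [Walk.edges_cons, List.nodup_cons, List.mem_cons] at this
    simp only [Finset.coe_erase, Set.mem_sdiff, Finset.mem_coe, mem_links, Set.mem_singleton_iff]
    exact ⟨p.edges_subset_edgeSet he, fun h => this.2.1 (h ▸ he)⟩
  -- If `w` and `x` were connected in `F`, uniqueness of tree paths would put the part of `q` before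
  -- `w` into `F`. Both deleted links would then lie on the part starting at `w`, but a path has
  -- only one link at its start.
  have hends : ∀ {x y : V} (q : T.Walk x y), q.IsPath → s(u, w) ∈ q.edges → s(w, z) ∈ q.edges →
      ¬ (fromEdgeSet (F : Set (Sym2 V))).Reachable w x := by
    intro x y q hq hq1 hq2 h
    obtain ⟨r, hr⟩ := h.symm.exists_isPath
    have hw : w ∈ q.support := Walk.fst_mem_support_of_mem_edges _ hq2
    have huniq : q.takeUntil w hw = r.mapLe hFT :=
      (hT.existsUnique_path x w).unique (hq.takeUntil hw) (hr.mapLe hFT)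
    have hnot : ∀ e ∈ (q.takeUntil w hw).edges, e ∈ F := by
      intro e he
      rw [huniq] at he
      have : e ∈ r.edges := by simpa using he
      have := r.edges_subset_edgeSet this
      rw [edgeSet_fromEdgeSet] at this
      exact this.1
    rw [← q.take_spec hw, Walk.edges_append, List.mem_append] at hq1 hq2
    have e1 : s(u, w) ∉ (q.takeUntil w hw).edges := fun h => by
      have := hnot _ h
      simp [hF] at this
    have e2 : s(w, z) ∉ (q.takeUntil w hw).edges := fun h => by
      have := hnot _ h
      simp [hF] at this
    have e1 := hq1.resolve_left e1
    rw [Sym2.eq_swap] at e1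
    exact huz (not_adj_two_of_isPath (hq.dropUntil hw) e1 (hq2.resolve_left e2))
  have hx := hends q hq hq1 hq2
  have hy := hends q.reverse hq.reverse (by simpa using hq1) (by simpa using hq2)
  intro hcon
  -- The component of `w` in `F` contains none of `u`, `v`, `x`, `y`, so the two added links do not
  -- leave it.
  refine hu (mem_of_reachable (S := {a | (fromEdgeSet (F : Set (Sym2 V))).Reachable w a}) ?_
    (hcon.preconnected w u) (Reachable.refl w))
  intro a b hadj (ha : (fromEdgeSet (F : Set (Sym2 V))).Reachable w a)
  rw [fromEdgeSet_adj] at hadj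
  obtain ⟨hab, hne⟩ := hadj
  simp only [Finset.coe_erase, Finset.coe_insert, Set.mem_sdiff, Set.mem_insert_iff,
    Set.mem_singleton_iff, Finset.mem_coe] at hab
  obtain ⟨⟨h | h | h, hn1⟩, hn2⟩ := hab
  · rw [Sym2.eq_iff] at h
    rcases h with ⟨rfl, rfl⟩ | ⟨rfl, rfl⟩
    · exact absurd ha hu
    · exact absurd ha hv
  · rw [Sym2.eq_iff] at h
    rcases h with ⟨rfl, rfl⟩ | ⟨rfl, rfl⟩
    · exact absurd ha hx
    · exact absurd ha hy
  · refine ha.trans (Adj.reachable ?_)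
    rw [fromEdgeSet_adj]
    exact ⟨by simp [hF, h, hn1, hn2], hne⟩

end Graphs

/-! ### At most one link outside a spanning tree -/

section Graphs

variable {V : Type*}

open SimpleGraph

/-- The ends of an open trail are the nodes that meet an odd number of its links, so the link set
determines them. -/
theorem endpoints_eq_of_edges_iff {G : SimpleGraph V} {u v x y : V} {p : G.Walk u v}
    {q : G.Walk x y} (hp : p.IsTrail) (hq : q.IsTrail) (huv : u ≠ v) (hxy : x ≠ y)
    (h : ∀ e, e ∈ p.edges ↔ e ∈ q.edges) : s(u, v) = s(x, y) := by
  classical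
  have hperm : p.edges.Perm q.edges :=
    (List.perm_ext_iff_of_nodup hp.edges_nodup hq.edges_nodup).2 h
  have key : ∀ w, (w ≠ u ∧ w ≠ v) ↔ (w ≠ x ∧ w ≠ y) := by
    intro w
    have h1 := hp.even_countP_edges_iff w
    have h2 := hq.even_countP_edges_iff w
    rw [hperm.countP_eq] at h1
    simp only [huv, hxy, ne_eq, not_false_eq_true, forall_const] at h1 h2
    exact h1.symm.trans h2
  have ku := key u
  have kv := key v
  rw [Sym2.eq_iff]
  grind

variable [Finite V]

/-- The nested case, by asummability for the pairs `{d₁, f}` and `{d₂, t}`, where `d₁, d₂` are the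
first two links of `p`. They exist because a path with a single link would put `s(u, v)` into the
tree. -/
theorem IsSeparable.not_two_extra_of_edges_subset {G : SimpleGraph V} (hG : IsSeparable G)
    {T : SimpleGraph V} (hT : T.IsTree) (hTG : T ≤ G) {u v x y : V} (he : s(u, v) ∈ links G)
    (heT : s(u, v) ∉ links T) (hf : s(x, y) ∈ links G) (hfT : s(x, y) ∉ links T)
    (hef : s(u, v) ≠ s(x, y)) {p : T.Walk u v} (hp : p.IsPath) {q : T.Walk x y} (hq : q.IsPath)
    (hpq : ∀ e ∈ p.edges, e ∈ q.edges) {t : Sym2 V} (htq : t ∈ q.edges) (htp : t ∉ p.edges) :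
    False := by
  classical
  have huv : u ≠ v := by simpa using G.ne_of_adj (by simpa using he)
  have hxy : x ≠ y := by simpa using G.ne_of_adj (by simpa using hf)
  have hpT : ∀ e ∈ p.edges, e ∈ links T := fun e he => by simpa using p.edges_subset_edgeSet he
  have hqT : ∀ e ∈ q.edges, e ∈ links T := fun e he => by simpa using q.edges_subset_edgeSet he
  have hTc : IsPathset (links T) := isPathset_links.2 hT.connected
  cases p with
  | nil => exact huv rfl
  | @cons _ w _ h1 p' =>
  cases p' with
  | nil => exact heT (by simpa using h1)
  | @cons _ z _ h2 p' =>
  have hmid := not_isPathset_of_two_consecutive hT h1 h2 p' hp hq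
    (hpq _ (by simp)) (hpq _ (by simp))
  have hd12 : s(u, w) ≠ s(w, z) := by
    have := hp.isTrail.edges_nodup
    simp only [Walk.edges_cons, List.nodup_cons, List.mem_cons, not_or] at this
    exact this.1.1
  set p := Walk.cons h1 (Walk.cons h2 p') with hpdef
  have hd1 : s(u, w) ∈ p.edges := by simp [hpdef]
  have hd2 : s(w, z) ∈ p.edges := by simp [hpdef]
  generalize s(u, w) = d₁ at *
  generalize s(w, z) = d₂ at *
  have hH : insert s(u, v) (insert s(x, y) (links T)) ⊆ links G := by
    intro e h
    simp only [Finset.mem_insert] at h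
    rcases h with rfl | rfl | h
    exacts [he, hf, links_mono hTG h]
  have hHc : IsPathset (insert s(u, v) (insert s(x, y) (links T))) :=
    hTc.mono fun e h => by simp [h]
  have hne : ∀ {a b : Sym2 V}, a ∈ links T → b ∉ links T → a ≠ b := fun ha hb h => hb (h ▸ ha)
  refine hG.asummable hH (a := d₁) (b := s(x, y)) (c := d₂) (d := t)
    (by simp [hpT _ hd1]) (by simp) (by simp [hpT _ hd2]) (by simp [hqT _ htq])
    (hne (hpT _ hd1) hfT) (fun h => htp (h ▸ hd2)) hd12 (hne (hqT _ htq) hfT).symm ?_ ?_ hmid ?_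
  · rw [Finset.erase_right_comm]
    refine IsPathset.erase_of_mem_isPath (p := p) ?_ huv hp ?_ ?_ (fun h => heT (hpT _ h)) hd1
    · refine hTc.mono fun e h => ?_
      simp [h, hne h hfT]
    · intro e h
      simp [hpT e h, hne (hpT e h) hfT]
    · simp [hef]
  -- The order matters: `t` is replaced by `f` while `q` is still intact; then `d₂` is replaced by
  -- `e`, as `p` does not contain `t`.
  · rw [Finset.erase_right_comm]
    refine IsPathset.erase_of_mem_isPath (p := p) ?_ huv hp ?_ ?_ (fun h => heT (hpT _ h)) hd2
    · refine IsPathset.erase_of_mem_isPath (p := q) hHc hxy hq ?_ ?_ (fun h => hfT (hqT _ h)) htq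
      · intro e h
        simp [hqT e h]
      · simp
    · intro e h
      have : e ≠ t := fun h' => htp (h' ▸ h)
      simp [hpT e h, this]
    · simp [(hne (hqT _ htq) heT).symm]
  · intro hcon
    have heq : ((insert s(u, v) (insert s(x, y) (links T))).erase s(x, y)).erase t =
        insert s(u, v) ((links T).erase t) := by
      ext e
      simp only [Finset.mem_erase, Finset.mem_insert]
      have a1 := hne (hqT _ htq) heT
      grind
    -- The tree path of the remaining extra link avoids `t`, so that link is redundant and `T - t`
    -- would be connected.
    rw [heq] at hcon
    refine not_isPathset_erase_of_isAcyclic hT.isAcyclic (hqT _ htq) (hcon.of_insert ?_)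
    refine reachable_of_edges_subset p fun e h => ?_
    have : e ≠ t := fun h' => htp (h' ▸ h)
    rw [Finset.mem_coe, Finset.mem_erase]
    exact ⟨this, hpT e h⟩

theorem IsSeparable.not_two_extra {G : SimpleGraph V} (hG : IsSeparable G)
    {T : SimpleGraph V} (hT : T.IsTree) (hTG : T ≤ G) {e f : Sym2 V} (he : e ∈ links G)
    (heT : e ∉ links T) (hf : f ∈ links G) (hfT : f ∉ links T) : e = f := by
  classical
  by_contra hef
  induction e with | h u v =>
  induction f with | h x y =>
  obtain ⟨p, hp⟩ := hT.connected.exists_isPath u v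
  obtain ⟨q, hq⟩ := hT.connected.exists_isPath x y
  have huv : u ≠ v := by simpa using G.ne_of_adj (by simpa using he)
  have hxy : x ≠ y := by simpa using G.ne_of_adj (by simpa using hf)
  by_cases h1 : ∃ s ∈ p.edges, s ∉ q.edges
  swap
  · push Not at h1
    by_cases h2 : ∃ t ∈ q.edges, t ∉ p.edges
    · obtain ⟨t, ht, ht'⟩ := h2
      exact hG.not_two_extra_of_edges_subset hT hTG he heT hf hfT hef hp hq h1 ht ht'
    · push Not at h2
      exact hef (endpoints_eq_of_edges_iff hp.isTrail hq.isTrail huv hxy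
        fun e => ⟨h1 e, h2 e⟩)
  by_cases h2 : ∃ t ∈ q.edges, t ∉ p.edges
  swap
  · push Not at h2
    obtain ⟨t, ht, ht'⟩ := h1
    exact hG.not_two_extra_of_edges_subset hT hTG hf hfT he heT (Ne.symm hef) hq hp h2 ht ht'
  obtain ⟨s, hsp, hsq⟩ := h1
  obtain ⟨t, htq, htp⟩ := h2
  have hpT : ∀ e ∈ p.edges, e ∈ links T := fun e he => by simpa using p.edges_subset_edgeSet he
  have hqT : ∀ e ∈ q.edges, e ∈ links T := fun e he => by simpa using q.edges_subset_edgeSet he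
  have hTc : IsPathset (links T) := isPathset_links.2 hT.connected
  have hst : s ≠ t := fun h => htp (h ▸ hsp)
  have hne : ∀ {a b : Sym2 V}, a ∈ links T → b ∉ links T → a ≠ b := fun ha hb h => hb (h ▸ ha)
  have hH : insert s(u, v) (insert s(x, y) (links T)) ⊆ links G := by
    intro e h
    simp only [Finset.mem_insert] at h
    rcases h with rfl | rfl | h
    exacts [he, hf, links_mono hTG h]
  have hHc : IsPathset (insert s(u, v) (insert s(x, y) (links T))) :=
    hTc.mono fun e h => by simp [h]
  have hsT := hpT s hsp
  have htT := hqT t htq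
  have s1 := hne hsT heT
  have s2 := hne hsT hfT
  have t1 := hne htT heT
  have t2 := hne htT hfT
  -- The incomparable case: swapping both extra links for `s` and `t` is harmless, but `e` cannot
  -- replace `t`, nor `f` replace `s`.
  refine hG.asummable hH (a := s(u, v)) (b := s(x, y)) (c := s) (d := t)
    (by simp) (by simp) (by simp [hsT]) (by simp [htT]) hef hst s1.symm t2.symm ?_ ?_ ?_ ?_
  · refine hTc.mono fun e h => ?_
    simp [h, hne h heT, hne h hfT]
  · refine IsPathset.erase_of_mem_isPath (p := q) ?_ hxy hq ?_ ?_ (fun h => hfT (hqT _ h)) htq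
    · refine IsPathset.erase_of_mem_isPath (p := p) hHc huv hp ?_ ?_ (fun h => heT (hpT _ h)) hsp
      · intro e h
        simp [hpT e h]
      · simp
    · intro e h
      have : e ≠ s := fun h' => hsq (h' ▸ h)
      simp [hqT e h, this]
    · simp [s2.symm]
  · intro hcon
    have heq : ((insert s(u, v) (insert s(x, y) (links T))).erase s(u, v)).erase s =
        insert s(x, y) ((links T).erase s) := by
      ext e
      simp only [Finset.mem_erase, Finset.mem_insert]
      grind
    rw [heq] at hcon
    refine not_isPathset_erase_of_isAcyclic hT.isAcyclic hsT (hcon.of_insert ?_)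
    refine reachable_of_edges_subset q fun e h => ?_
    have : e ≠ s := fun h' => hsq (h' ▸ h)
    rw [Finset.mem_coe, Finset.mem_erase]
    exact ⟨this, hqT e h⟩
  · intro hcon
    have heq : ((insert s(u, v) (insert s(x, y) (links T))).erase s(x, y)).erase t =
        insert s(u, v) ((links T).erase t) := by
      ext e
      simp only [Finset.mem_erase, Finset.mem_insert]
      grind
    rw [heq] at hcon
    refine not_isPathset_erase_of_isAcyclic hT.isAcyclic htT (hcon.of_insert ?_)
    refine reachable_of_edges_subset p fun e h => ?_
    have : e ≠ t := fun h' => htp (h' ▸ h)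
    rw [Finset.mem_coe, Finset.mem_erase]
    exact ⟨this, hpT e h⟩

theorem isTree_iff_connected_and_card_links {G : SimpleGraph V} :
    G.IsTree ↔ G.Connected ∧ (links G).card + 1 = Nat.card V := by
  rw [isTree_iff_connected_and_card, card_links]

theorem IsPathset.card_le {E : Finset (Sym2 V)} (h : IsPathset E) : Nat.card V ≤ E.card + 1 := by
  refine (SimpleGraph.Connected.card_vert_le_card_edgeSet_add_one h).trans ?_
  rw [edgeSet_fromEdgeSet, Nat.card_coe_set_eq, ← Set.ncard_coe_finset E]
  exact Nat.add_le_add_right (Set.ncard_le_ncard Set.sdiff_subset) 1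

/-- A separable connected graph is a tree, or a tree with one additional link. -/
theorem IsSeparable.isTree_or {G : SimpleGraph V} (hG : IsSeparable G) (hc : G.Connected) :
    G.IsTree ∨ ∃ (T : SimpleGraph V) (u v : V), T.IsTree ∧ T ≤ G ∧ s(u, v) ∈ links G ∧
      s(u, v) ∉ links T ∧ ∀ e ∈ links G, e ∈ links T ∨ e = s(u, v) := by
  obtain ⟨T, hTG, hT⟩ := hc.exists_isTree_le
  by_cases h : ∃ e ∈ links G, e ∉ links T
  · right
    obtain ⟨e, he, heT⟩ := h
    induction e with | h u v =>
    refine ⟨T, u, v, hT, hTG, he, heT, fun f hf => ?_⟩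
    by_cases hfT : f ∈ links T
    · exact Or.inl hfT
    · exact Or.inr (hG.not_two_extra hT hTG hf hfT he heT)
  · left
    push Not at h
    have : G = T := le_antisymm (by
      rw [← edgeSet_subset_edgeSet]
      exact fun e he => mem_links.1 (h e (mem_links.2 he))) hTG
    exact this ▸ hT

/-- The only consequence of separability that the correctness of the program uses. -/
theorem IsSeparable.card_links_le {G : SimpleGraph V} (hG : IsSeparable G) (hc : G.Connected) :
    (links G).card ≤ Nat.card V := by
  classical
  rcases hG.isTree_or hc with h | ⟨T, u, v, hT, -, -, -, h⟩
  · have := (isTree_iff_connected_and_card_links.1 h).2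
    omega
  · have h1 := (isTree_iff_connected_and_card_links.1 hT).2
    have h2 : (links G).card ≤ (insert s(u, v) (links T)).card :=
      Finset.card_le_card fun e he => by
        rw [Finset.mem_insert]
        exact (h e he).symm
    have h3 := Finset.card_insert_le s(u, v) (links T)
    omega

end Graphs

/-! ### Cycles with hanging trees -/

section Graphs

variable {V : Type*}

open SimpleGraph

theorem reachable_support {G : SimpleGraph V} {u v : V} (p : G.Walk u v) {x y : V}
    (hx : x ∈ p.support) (hy : y ∈ p.support) : G.Reachable x y := by
  classical
  exact ⟨(p.takeUntil x hx).reverse.append (p.takeUntil y hy)⟩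

/-- Two nodes of a path in a forest that are joined without links of the path coincide. -/
theorem eq_of_reachable_avoiding {T F : SimpleGraph V} (hT : T.IsAcyclic) (hFT : F ≤ T) {u v : V}
    {p : T.Walk u v} (hp : p.IsPath) (hF : ∀ e ∈ F.edgeSet, e ∉ p.edges) {x y : V}
    (hx : x ∈ p.support) (hy : y ∈ p.support) (h : F.Reachable x y) : x = y := by
  classical
  have key : ∀ {x y : V} (s : T.Walk x y), s.IsPath → (∀ e ∈ s.edges, e ∈ p.edges) →
      F.Reachable x y → x = y := by
    intro x y s hs hsp h
    obtain ⟨r, hr⟩ := h.exists_isPath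
    have huniq : s = r.mapLe hFT := by
      have := hT.subsingleton_path x y
      exact congrArg Subtype.val (Subsingleton.elim (⟨_, hs⟩ : T.Path x y)
        ⟨_, hr.mapLe hFT⟩)
    cases r with
    | nil => rfl
    | @cons _ z _ hadj r =>
      -- A nonempty connection in `F` is, by uniqueness of paths in a forest, the segment of `p`, so
      -- its first link is in both `F` and `p`.
      refine absurd (hsp s(x, z) ?_) (hF s(x, z) hadj)
      rw [huniq]
      simp
  have hy' := hy
  rw [← p.take_spec hx, Walk.mem_support_append_iff] at hy'
  rcases hy' with hy' | hy'
  · refine (key ((p.takeUntil x hx).dropUntil y hy') ((hp.takeUntil hx).dropUntil hy') ?_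
      h.symm).symm
    exact fun e he => p.edges_takeUntil_subset_edges hx (Walk.edges_dropUntil_subset_edges _ hy' he)
  · refine key ((p.dropUntil x hx).takeUntil y hy') ((hp.dropUntil hx).takeUntil hy') ?_ h
    exact fun e he => p.edges_dropUntil_subset_edges hx (Walk.edges_takeUntil_subset_edges _ hy' he)

/-- Adding the links of a path to a forest whose trees contain at most one node of the path yields
a forest. -/
theorem isAcyclic_sup_path {G F : SimpleGraph V} (hF : F.IsAcyclic) {u v : V} (p : G.Walk u v)
    (hp : p.IsPath) (hd : ∀ x ∈ p.support, ∀ y ∈ p.support, F.Reachable x y → x = y) :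
    (F ⊔ fromEdgeSet {e | e ∈ p.edges}).IsAcyclic := by
  induction p with
  | nil => simpa using hF
  | @cons a b _ h p ih =>
    rw [Walk.cons_isPath_iff] at hp
    have ih := ih hp.1 fun x hx y hy => hd x (by simp [hx]) y (by simp [hy])
    have heq : F ⊔ fromEdgeSet {e | e ∈ (Walk.cons h p).edges} =
        (F ⊔ fromEdgeSet {e | e ∈ p.edges}) ⊔ edge a b := by
      rw [sup_assoc]
      congr 1
      ext x y
      simp [edge_adj, or_comm, or_and_right]
    rw [heq]
    refine ih.sup_edge_of_not_reachable fun hr => ?_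
    -- All nodes reachable from `b` hang in `F` from a node of the rest of the path, and the first
    -- node `a` hangs only from itself.
    have : a ∈ {x | ∃ y ∈ p.support, F.Reachable y x} := by
      refine mem_of_reachable ?_ hr.symm ⟨b, p.start_mem_support, Reachable.refl _⟩
      rintro x y hxy ⟨z, hz, hzx⟩
      rw [sup_adj] at hxy
      rcases hxy with hxy | hxy
      · exact ⟨z, hz, hzx.trans hxy.reachable⟩
      · rw [fromEdgeSet_adj] at hxy
        exact ⟨y, p.snd_mem_support_of_mem_edges hxy.1, Reachable.refl _⟩
    obtain ⟨y, hy, hya⟩ := this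
    have := hd y (by simp [hy]) a (by simp) hya
    exact hp.2 (this ▸ hy)

theorem isElementaryCycle_of_pendantPart_eq_bot {G : SimpleGraph V} {u : V} {c : G.Walk u u}
    (hc : c.IsCycle) (h : pendantPart G c = ⊥)
    (hr : ∀ v, ∃ x, x ∈ c.support ∧ (pendantPart G c).Reachable v x) : IsElementaryCycle G := by
  refine ⟨u, c, hc, fun v => ?_, fun e he => ?_⟩
  · obtain ⟨x, hx, hvx⟩ := hr v
    rw [h, reachable_bot] at hvx
    exact hvx ▸ hx
  · by_contra hne
    have : e ∈ (pendantPart G c).edgeSet := by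
      rw [pendantPart, edgeSet_deleteEdges]
      exact ⟨he, hne⟩
    rw [h] at this
    simp at this

theorem mem_walkLinks {G : SimpleGraph V} {u : V} {c : G.Walk u u} {e : Sym2 V} :
    e ∈ walkLinks c ↔ e ∈ c.edges := by
  simp [walkLinks]

variable [Finite V]

/-- A tree with one additional link is a cycle with trees hanging from its nodes. -/
theorem exists_cycle_of_tree_insert {G T : SimpleGraph V} (hT : T.IsTree) (hTG : T ≤ G) {u v : V}
    (he : s(u, v) ∈ links G) (heT : s(u, v) ∉ links T)
    (hG : ∀ e ∈ links G, e ∈ links T ∨ e = s(u, v)) :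
    ∃ (w : V) (c : G.Walk w w), c.IsCycle ∧ (pendantPart G c).IsAcyclic ∧
      ∀ v, ∃! x, x ∈ c.support ∧ (pendantPart G c).Reachable v x := by
  obtain ⟨p, hp⟩ := hT.connected.exists_isPath u v
  have hadj : G.Adj v u := by simpa [adj_comm] using he
  have hpT : ∀ e ∈ p.edges, e ∈ links T := fun e he => by simpa using p.edges_subset_edgeSet he
  -- The cycle is the tree path of the extra link, closed by this link.
  set c := Walk.cons hadj (p.mapLe hTG) with hc
  have hce : ∀ e, e ∈ c.edges ↔ e = s(u, v) ∨ e ∈ p.edges := by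
    intro e
    simp [hc, Sym2.eq_swap]
  have hcs : ∀ x, x ∈ c.support ↔ x ∈ p.support := by
    intro x
    simp only [hc, Walk.support_cons, Walk.support_mapLe_eq_support, List.mem_cons,
      or_iff_right_iff_imp]
    rintro rfl
    exact p.end_mem_support
  have hFT : pendantPart G c ≤ T := by
    intro a b h
    rw [pendantPart, deleteEdges_adj] at h
    have h2 : s(a, b) ∉ c.edges := h.2
    rw [hce, not_or] at h2
    simpa using (hG s(a, b) (by simpa using h.1)).resolve_right h2.1
  have hF : ∀ e ∈ (pendantPart G c).edgeSet, e ∉ p.edges := by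
    intro e h
    rw [pendantPart, edgeSet_deleteEdges] at h
    have h2 : e ∉ c.edges := h.2
    rw [hce, not_or] at h2
    exact h2.2
  refine ⟨v, c, ?_, hT.isAcyclic.anti hFT, fun w => ?_⟩
  · rw [hc, Walk.cons_isCycle_iff]
    refine ⟨hp.mapLe hTG, ?_⟩
    rw [Walk.edges_mapLe_eq_edges, Sym2.eq_swap]
    exact fun h => heT (hpT _ h)
  -- A node is joined to the cycle by following the tree to `u`: a tree link either avoids the cycle
  -- or ends on it.
  · have hex : w ∈ {w | ∃ x ∈ p.support, (pendantPart G c).Reachable w x} := by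
      refine mem_of_reachable ?_ (hT.connected.preconnected u w)
        ⟨u, p.start_mem_support, Reachable.refl _⟩
      rintro a b hab ⟨x, hx, hax⟩
      by_cases hm : s(a, b) ∈ p.edges
      · exact ⟨b, p.snd_mem_support_of_mem_edges hm, Reachable.refl _⟩
      · refine ⟨x, hx, Reachable.trans (Adj.reachable ?_) hax⟩
        rw [adj_comm, pendantPart, deleteEdges_adj]
        refine ⟨hTG hab, fun h => ?_⟩
        have h : s(a, b) ∈ c.edges := h
        rw [hce] at h
        rcases h with h | h
        · exact heT (h ▸ by simpa using hab)
        · exact hm h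
    obtain ⟨x, hx, hwx⟩ := hex
    refine ⟨x, ⟨(hcs x).2 hx, hwx⟩, ?_⟩
    rintro y ⟨hy, hwy⟩
    exact eq_of_reachable_avoiding hT.isAcyclic hFT hp hF ((hcs y).1 hy) hx (hwy.symm.trans hwx)

theorem IsSeparable.classification {G : SimpleGraph V} (hG : IsSeparable G) :
    (¬ G.Connected) ∨ G.IsTree ∨ IsElementaryCycle G ∨
      ∃ (u : V) (c : G.Walk u u), IsCycleWithArborescences G c := by
  by_cases hc : G.Connected
  swap
  · exact Or.inl hc
  right
  rcases hG.isTree_or hc with h | ⟨T, u, v, hT, hTG, he, heT, h⟩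
  · exact Or.inl h
  right
  obtain ⟨w, c, hcyc, hac, huniq⟩ := exists_cycle_of_tree_insert hT hTG he heT h
  by_cases hb : pendantPart G c = ⊥
  · exact Or.inl (isElementaryCycle_of_pendantPart_eq_bot hcyc hb fun v => (huniq v).exists)
  · exact Or.inr ⟨w, c, hcyc, hb, hac, huniq⟩

/-- The number of links of a cycle with hanging trees is the number of its nodes. -/
theorem connected_and_card_of_hanging {G : SimpleGraph V} {u : V} {c : G.Walk u u}
    (hc : c.IsCycle) (hF : (pendantPart G c).IsAcyclic)
    (hu : ∀ v, ∃! x, x ∈ c.support ∧ (pendantPart G c).Reachable v x) :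
    G.Connected ∧ (links G).card = Nat.card V := by
  classical
  have hle : pendantPart G c ≤ G := deleteEdges_le _
  have hconn : G.Connected := by
    rw [connected_iff_exists_forall_reachable]
    refine ⟨u, fun v => ?_⟩
    obtain ⟨x, ⟨hx, hvx⟩, -⟩ := hu v
    exact (reachable_support c c.start_mem_support hx).trans (hvx.mono hle).symm
  refine ⟨hconn, ?_⟩
  cases c with
  | nil => simp at hc
  | @cons _ w _ hadj p =>
  have hcc := hc
  rw [Walk.cons_isCycle_iff] at hc
  -- Without its first link the cycle is a path, which joined to the hanging forest stays acyclic.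
  -- So deleting this link leaves a tree with one link fewer than nodes.
  have hac := isAcyclic_sup_path hF p hc.1 (by
    intro x hx y hy hxy
    obtain ⟨z, -, hz⟩ := hu x
    rw [hz x ⟨by simp [hx], Reachable.refl _⟩, hz y ⟨by simp [hy], hxy⟩])
  have heq : fromEdgeSet ((((links G).erase s(u, w) : Finset (Sym2 V))) : Set (Sym2 V)) =
      pendantPart G (Walk.cons hadj p) ⊔ fromEdgeSet {e | e ∈ p.edges} := by
    rw [← deleteEdges_singleton_eq (fromEdgeSet_links G)]
    ext a b
    simp only [pendantPart, deleteEdges_adj, sup_adj, fromEdgeSet_adj, Set.mem_singleton_iff,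
      Set.mem_ofPred_eq, Walk.edges_cons, List.mem_cons]
    constructor
    · rintro ⟨h1, h2⟩
      by_cases h : s(a, b) ∈ p.edges
      · exact Or.inr ⟨h, h1.ne⟩
      · exact Or.inl ⟨h1, by simp [h, h2]⟩
    · rintro (⟨h1, h2⟩ | ⟨h1, h2⟩)
      · exact ⟨h1, fun h => h2 (Or.inl h)⟩
      · exact ⟨p.edges_subset_edgeSet h1, fun h => hc.2 (h ▸ h1)⟩
  rw [← heq] at hac
  have hmem : s(u, w) ∈ links G := by simpa using hadj
  have hpath := (isPathset_links.2 hconn).erase_of_mem_isCycle hcc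
    (fun e he => by simpa using (Walk.cons hadj p).edges_subset_edgeSet he)
    (t := s(u, w)) (by simp)
  have htree : (fromEdgeSet ((((links G).erase s(u, w) : Finset (Sym2 V))) : Set (Sym2 V))).IsTree :=
    ⟨hpath, hac⟩
  have h1 := (isTree_iff_connected_and_card_links.1 htree).2
  have h2 : links (fromEdgeSet ((((links G).erase s(u, w) : Finset (Sym2 V))) : Set (Sym2 V))) =
      (links G).erase s(u, w) := by
    rw [← deleteEdges_singleton_eq (fromEdgeSet_links G)]
    ext e
    simp [and_comm]
  rw [h2, Finset.card_erase_of_mem hmem] at h1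
  have : 0 < (links G).card := Finset.card_pos.2 ⟨_, hmem⟩
  omega

/-! ### Reliability formulas -/

open scoped Classical in
theorem reliability_eq_zero {G : SimpleGraph V} (h : ¬ G.Connected) (p : Sym2 V → ℝ) :
    reliability G p = 0 := by
  rw [reliability, Finset.filter_false_of_mem, Finset.sum_empty]
  intro E hE hc
  exact h (isPathset_links.1 (hc.mono (Finset.mem_powerset.1 hE)))

open scoped Classical in
/-- The reliability of a connected graph with at most as many links as nodes. -/
theorem reliability_eq_of_card_le {G : SimpleGraph V} (hc : G.Connected)
    (hcard : (links G).card ≤ Nat.card V) (p : Sym2 V → ℝ) :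
    reliability G p = ∏ e ∈ links G, p e +
      ∑ e ∈ links G with IsPathset ((links G).erase e),
        (1 - p e) * ∏ e' ∈ (links G).erase e, p e' := by
  -- A pathset has at least `|V| - 1` links, hence misses at most one.
  have hset : ((links G).powerset.filter IsPathset) = insert (links G)
      (((links G).filter fun e => IsPathset ((links G).erase e)).image (links G).erase) := by
    ext E
    simp only [Finset.mem_filter, Finset.mem_powerset, Finset.mem_insert, Finset.mem_image]
    constructor
    · rintro ⟨hE, hp⟩
      have h1 := hp.card_le
      have h2 := Finset.card_sdiff_add_card_eq_card hE
      rcases Nat.lt_or_ge (links G \ E).card 1 with h | h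
      · left
        have : links G \ E = ∅ := Finset.card_eq_zero.1 (by omega)
        exact Finset.Subset.antisymm hE (Finset.sdiff_eq_empty_iff_subset.1 this)
      · right
        obtain ⟨e, he⟩ := Finset.card_eq_one.1 (show (links G \ E).card = 1 by omega)
        have hE' : (links G).erase e = E := by
          rw [← Finset.sdiff_singleton_eq_erase, ← he, Finset.sdiff_sdiff_eq_self hE]
        have hmem : e ∈ links G \ E := by simp [he]
        exact ⟨e, ⟨(Finset.mem_sdiff.1 hmem).1, hE' ▸ hp⟩, hE'⟩
    · rintro (rfl | ⟨e, ⟨he, hp⟩, rfl⟩)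
      · exact ⟨subset_rfl, isPathset_links.2 hc⟩
      · exact ⟨Finset.erase_subset _ _, hp⟩
  rw [reliability, hset, Finset.sum_insert, Finset.sum_image]
  · congr 1
    · simp
    · refine Finset.sum_congr rfl fun e he => ?_
      have he := (Finset.mem_filter.1 he).1
      have : links G \ (links G).erase e = {e} := by
        rw [← Finset.sdiff_singleton_eq_erase, Finset.sdiff_sdiff_eq_self (by simpa using he)]
      rw [this, Finset.prod_singleton, mul_comm]
  · intro a ha b hb hab
    exact (Finset.erase_inj _ (Finset.mem_filter.1 ha).1).1 hab
  · simp only [Finset.mem_image, not_exists, not_and]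
    intro e he h
    exact Finset.erase_ne_self.2 (Finset.mem_filter.1 he).1 h

theorem reliability_of_isTree {G : SimpleGraph V} (h : G.IsTree) (p : Sym2 V → ℝ) :
    reliability G p = ∏ e ∈ links G, p e := by
  classical
  have hc := isTree_iff_connected_and_card_links.1 h
  rw [reliability_eq_of_card_le hc.1 (by omega), Finset.sum_eq_zero, add_zero]
  intro e he
  have he := Finset.mem_filter.1 he
  exact absurd he.2 (by convert! not_isPathset_erase_of_isAcyclic h.isAcyclic he.1)

/-- If a link off the cycle could be deleted, the remaining connected graph would have `|V| - 1`
links, hence be a tree, but it would still contain the cycle. -/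
theorem isPathset_erase_iff_of_hanging [DecidableEq V] {G : SimpleGraph V} {u : V} {c : G.Walk u u}
    (hc : c.IsCycle) (hF : (pendantPart G c).IsAcyclic)
    (hu : ∀ v, ∃! x, x ∈ c.support ∧ (pendantPart G c).Reachable v x) {e : Sym2 V}
    (he : e ∈ links G) : IsPathset ((links G).erase e) ↔ e ∈ c.edges := by
  obtain ⟨hconn, hcard⟩ := connected_and_card_of_hanging hc hF hu
  have hcl : ∀ e ∈ c.edges, e ∈ links G := fun e he => by simpa using c.edges_subset_edgeSet he
  refine ⟨fun h => ?_, fun h => (isPathset_links.2 hconn).erase_of_mem_isCycle hc hcl h⟩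
  by_contra hne
  rw [IsPathset, ← deleteEdges_singleton_eq (fromEdgeSet_links G)] at h
  have hl : links (G.deleteEdges {e}) = (links G).erase e := by
    ext f
    simp [and_comm]
  have htree : (G.deleteEdges {e}).IsTree := by
    rw [isTree_iff_connected_and_card_links, hl, Finset.card_erase_of_mem he]
    have : 0 < (links G).card := Finset.card_pos.2 ⟨_, he⟩
    exact ⟨h, by omega⟩
  have htr : ∀ f ∈ c.edges, f ∈ (G.deleteEdges {e}).edgeSet := fun f hf => by
    rw [← mem_links, hl, Finset.mem_erase]
    exact ⟨fun h => hne (h ▸ hf), hcl f hf⟩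
  exact htree.isAcyclic _ (hc.transfer htr)

/-- Every connected state contains all hanging links, so their product factors out. No hanging link
is required, so elementary cycles are covered as well. -/
theorem reliability_of_hanging {G : SimpleGraph V} {u : V} {c : G.Walk u u}
    (hc : c.IsCycle) (hF : (pendantPart G c).IsAcyclic)
    (hu : ∀ v, ∃! x, x ∈ c.support ∧ (pendantPart G c).Reachable v x) (p : Sym2 V → ℝ) :
    reliability G p = cycleTerm (walkLinks c) p * ∏ e ∈ links (pendantPart G c), p e := by
  classical
  obtain ⟨hconn, hcard⟩ := connected_and_card_of_hanging hc hF hu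
  have hcl : walkLinks c ⊆ links G := fun e he => by
    simpa using c.edges_subset_edgeSet (mem_walkLinks.1 he)
  have hpl : links (pendantPart G c) = links G \ walkLinks c := by
    ext e
    simp [pendantPart, mem_walkLinks]
  have hfilter : (links G).filter (fun e => IsPathset ((links G).erase e)) = walkLinks c := by
    ext e
    rw [Finset.mem_filter, mem_walkLinks]
    constructor
    · rintro ⟨h1, h2⟩
      exact (isPathset_erase_iff_of_hanging hc hF hu h1).1 (by convert! h2)
    · intro h
      have h1 := hcl (mem_walkLinks.2 h)
      exact ⟨h1, by convert! (isPathset_erase_iff_of_hanging hc hF hu h1).2 h⟩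
  rw [reliability_eq_of_card_le hconn hcard.le, hfilter, hpl, cycleTerm, add_mul, Finset.sum_mul]
  congr 1
  · rw [mul_comm, Finset.prod_sdiff hcl]
  · refine Finset.sum_congr rfl fun e he => ?_
    rw [mul_assoc]
    congr 1
    have : links G \ walkLinks c = (links G).erase e \ (walkLinks c).erase e := by
      ext f
      simp only [Finset.mem_sdiff, Finset.mem_erase]
      grind
    rw [this, mul_comm, Finset.prod_sdiff (Finset.erase_subset_erase _ hcl)]

theorem reliability_of_isElementaryCycle {G : SimpleGraph V} (h : IsElementaryCycle G)
    (p : Sym2 V → ℝ) : reliability G p = cycleTerm (links G) p := by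
  obtain ⟨u, c, hc, hs, he⟩ := h
  have hb : pendantPart G c = ⊥ := by
    rw [← edgeSet_eq_empty, pendantPart, edgeSet_deleteEdges]
    ext e
    simpa using he e
  have hw : walkLinks c = links G := by
    ext e
    rw [mem_walkLinks, mem_links]
    exact ⟨fun h => c.edges_subset_edgeSet h, he e⟩
  rw [reliability_of_hanging hc, hb, hw]
  · simp [links]
  · rw [hb]
    exact isAcyclic_bot
  · intro v
    refine ⟨v, ⟨hs v, Reachable.refl _⟩, fun y hy => ?_⟩
    rw [hb, reachable_bot] at hy
    exact hy.2.symm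

end Graphs

/-! ### A program logic with time budgets -/

@[simp] theorem State.reg_setReg (s : State) (x v y : ℕ) :
    (s.setReg x v).reg y = if y = x then v else s.reg y := by
  simp [State.setReg, Function.update_apply]

@[simp] theorem State.arr_setReg (s : State) (x v : ℕ) : (s.setReg x v).arr = s.arr := rfl

@[simp] theorem State.reg_setArr (s : State) (a i v : ℕ) : (s.setArr a i v).reg = s.reg := rfl

@[simp] theorem State.arr_setArr (s : State) (a i v b : ℕ) :
    (s.setArr a i v).arr b = if b = a then Function.update (s.arr a) i v else s.arr b := by
  simp [State.setArr, Function.update_apply]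

/-- All registers and array entries have at most `L` binary digits. -/
def State.Small (L : ℕ) (s : State) : Prop :=
  (∀ x, s.reg x < 2 ^ L) ∧ ∀ a i, s.arr a i < 2 ^ L

theorem State.Small.setReg {L : ℕ} {s : State} (h : s.Small L) {x v : ℕ} (hv : v < 2 ^ L) :
    (s.setReg x v).Small L := by
  refine ⟨fun y => ?_, h.2⟩
  rw [State.reg_setReg]
  split_ifs
  exacts [hv, h.1 y]

theorem State.Small.setArr {L : ℕ} {s : State} (h : s.Small L) {a i v : ℕ} (hv : v < 2 ^ L) :
    (s.setArr a i v).Small L := by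
  refine ⟨h.1, fun b j => ?_⟩
  rw [State.arr_setArr]
  split_ifs with hb
  · rw [Function.update_apply]
    split_ifs
    exacts [hv, h.2 a j]
  · exact h.2 b j

/-- Started in `s`, a state with entries of at most `L` digits, the program `P` halts after some
number `t` of operations of logarithmic cost at most `3 * L + 1`, in a state `s'` of the same kind
such that `Q s' t` holds. -/
def Halts (L : ℕ) (P : Prog) (s : State) (Q : State → ℕ → Prop) : Prop :=
  s.Small L → ∃ s' t b, Runs P s s' t b ∧ b ≤ t * (3 * L + 1) ∧ s'.Small L ∧ Q s' t

theorem Halts.imp {L : ℕ} {P : Prog} {s : State} {Q R : State → ℕ → Prop} (h : Halts L P s Q)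
    (hQR : ∀ s' t, Q s' t → R s' t) : Halts L P s R := fun hs => by
  obtain ⟨s', t, b, h1, h2, h3, h4⟩ := h hs
  exact ⟨s', t, b, h1, h2, h3, hQR _ _ h4⟩

theorem Halts.seq {L : ℕ} {P P' : Prog} {s : State} {Q : State → ℕ → Prop}
    (h : Halts L P s fun s' t => Halts L P' s' fun s'' t' => Q s'' (t + t')) :
    Halts L (.seq P P') s Q := fun hs => by
  obtain ⟨s', t, b, h1, h2, h3, h4⟩ := h hs
  obtain ⟨s'', t', b', h1', h2', h3', h4'⟩ := h4 h3
  exact ⟨s'', t + t', b + b', .seq h1 h1', by rw [add_mul]; omega, h3', h4'⟩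

theorem Test.cost_le {L : ℕ} {s : State} (hs : s.Small L) (β : Test) : β.cost s ≤ 3 * L + 1 := by
  cases β with
  | lt x y | eq x y =>
    have h1 := Nat.size_le.2 (hs.1 x)
    have h2 := Nat.size_le.2 (hs.1 y)
    simp only [Test.cost]
    omega

theorem Halts.ite {L : ℕ} {β : Test} {P P' : Prog} {s : State} {Q : State → ℕ → Prop}
    (h : β.holds s → Halts L P s fun s' t => Q s' (1 + t))
    (h' : ¬ β.holds s → Halts L P' s fun s' t => Q s' (1 + t)) :
    Halts L (.ite β P P') s Q := fun hs => by
  have hβ := β.cost_le hs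
  by_cases hb : β.holds s
  · obtain ⟨s', t, b, h1, h2, h3, h4⟩ := h hb hs
    exact ⟨s', _, _, .ite_true hb h1, by rw [add_mul]; omega, h3, h4⟩
  · obtain ⟨s', t, b, h1, h2, h3, h4⟩ := h' hb hs
    exact ⟨s', _, _, .ite_false hb h1, by rw [add_mul]; omega, h3, h4⟩

/-- Loops: `I s k` is an invariant, where `k` is the number of operations that may still be spent. -/
theorem Halts.while {L : ℕ} {β : Test} {P : Prog} (I : State → ℕ → Prop)
    (hstep : ∀ s k, I s k → β.holds s →
      Halts L P s fun s' t => ∃ k', I s' k' ∧ t + k' + 1 ≤ k)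
    {s : State} {k : ℕ} (h : I s k) :
    Halts L (.while β P) s fun s' t => ¬ β.holds s' ∧ ∃ k', I s' k' ∧ t + k' ≤ k + 1 := by
  -- Each round uses up budget, which yields termination and the time bound at once. The `+ 1` in
  -- the conclusion pays for the final failing test.
  induction k using Nat.strong_induction_on generalizing s with
  | _ k ih =>
    intro hs
    have hβ := β.cost_le hs
    by_cases hb : β.holds s
    · obtain ⟨s', t, b, h1, h2, h3, k', h4, h5⟩ := hstep s k h hb hs
      obtain ⟨s'', t', b', h1', h2', h3', h4', k'', h5', h6'⟩ := ih k' (by omega) h4 h3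
      refine ⟨s'', _, _, .while_true hb h1 h1', ?_, h3', h4', k'', h5', by omega⟩
      rw [add_mul, add_mul]
      omega
    · exact ⟨s, 1, _, .while_false hb, by omega, hs, hb, k, h, by omega⟩

/-- A sufficient condition for `Halts`, by symbolic execution up to the loops. -/
def Prog.Vc (L : ℕ) : Prog → State → (State → ℕ → Prop) → Prop
  | .skip, s, Q => Q s 1
  | .const x k, s, Q => k < 2 ^ L ∧ Q (s.setReg x k) 1
  | .arith o x y z, s, Q =>
      o.eval (s.reg y) (s.reg z) < 2 ^ L ∧ Q (s.setReg x (o.eval (s.reg y) (s.reg z))) 1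
  | .load x a i, s, Q => Q (s.setReg x (s.arr a (s.reg i))) 1
  | .store a i y, s, Q => Q (s.setArr a (s.reg i) (s.reg y)) 1
  | .seq P P', s, Q => P.Vc L s fun s' t => P'.Vc L s' fun s'' t' => Q s'' (t + t')
  | .ite β P P', s, Q =>
      (β.holds s → P.Vc L s fun s' t => Q s' (1 + t)) ∧
        (¬ β.holds s → P'.Vc L s fun s' t => Q s' (1 + t))
  | .while β P, s, Q => Halts L (.while β P) s Q

theorem Prog.Vc.imp {L : ℕ} {P : Prog} {s : State} {Q R : State → ℕ → Prop} (h : P.Vc L s Q)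
    (hQR : ∀ s' t, Q s' t → R s' t) : P.Vc L s R := by
  induction P generalizing s Q R with
  | skip | load | store => exact hQR _ _ h
  | const | arith => exact ⟨h.1, hQR _ _ h.2⟩
  | seq P P' ih ih' => exact ih h fun s' t h' => ih' h' fun _ _ => hQR _ _
  | ite β P P' ih ih' =>
    exact ⟨fun hb => ih (h.1 hb) fun _ _ => hQR _ _, fun hb => ih' (h.2 hb) fun _ _ => hQR _ _⟩
  | _ => exact Halts.imp h hQR

theorem Halts.of_vc {L : ℕ} {P : Prog} {s : State} {Q : State → ℕ → Prop} (h : P.Vc L s Q) :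
    Halts L P s Q := by
  induction P generalizing s Q with
  | skip => exact fun hs => ⟨s, 1, 1, .skip s, by omega, hs, h⟩
  | const x k =>
    refine fun hs => ⟨_, _, _, .const s x k, ?_, hs.setReg h.1, h.2⟩
    have := Nat.size_le.2 h.1
    omega
  | arith o x y z =>
    refine fun hs => ⟨_, _, _, .arith s o x y z, ?_, hs.setReg h.1, h.2⟩
    have h1 := Nat.size_le.2 h.1
    have h2 := Nat.size_le.2 (hs.1 y)
    have h3 := Nat.size_le.2 (hs.1 z)
    omega
  | load x a i =>
    refine fun hs => ⟨_, _, _, .load s x a i, ?_, hs.setReg (hs.2 _ _), h⟩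
    have h1 := Nat.size_le.2 (hs.1 i)
    have h2 := Nat.size_le.2 (hs.2 a (s.reg i))
    omega
  | store a i y =>
    refine fun hs => ⟨_, _, _, .store s a i y, ?_, hs.setArr (hs.1 _), h⟩
    have h1 := Nat.size_le.2 (hs.1 i)
    have h2 := Nat.size_le.2 (hs.1 y)
    omega
  | seq P P' ih ih' => exact Halts.seq (ih (Prog.Vc.imp (P := P) h fun _ _ h' => ih' h'))
  | ite β P P' ih ih' => exact Halts.ite (fun hb => ih (h.1 hb)) fun hb => ih' (h.2 hb)
  | _ => exact h

/-- Sequential composition of a list of programs. -/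
def Prog.block : List Prog → Prog
  | [] => .skip
  | P :: l => .seq P (block l)

@[simp] theorem Prog.vc_block_nil {L : ℕ} {s : State} {Q : State → ℕ → Prop} :
    (Prog.block []).Vc L s Q ↔ Q s 1 := Iff.rfl

@[simp] theorem Prog.vc_block_cons {L : ℕ} {P : Prog} {l : List Prog} {s : State}
    {Q : State → ℕ → Prop} : (Prog.block (P :: l)).Vc L s Q ↔
      P.Vc L s fun s' t => (Prog.block l).Vc L s' fun s'' t' => Q s'' (t + t') := Iff.rfl

theorem Halts.block_cons {L : ℕ} {P : Prog} {l : List Prog} {s : State} {Q : State → ℕ → Prop}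
    (h : Halts L P s fun s' t => Halts L (.block l) s' fun s'' t' => Q s'' (t + t')) :
    Halts L (.block (P :: l)) s Q := Halts.seq h

/-! ### Adjacency lists -/

/-- The neighbours of `v` along the first `j` links, where the link `i` is ignored. -/
def nbrs (S T : ℕ → ℕ) (i : ℕ) : ℕ → ℕ → List ℕ
  | 0, _ => []
  | j + 1, v =>
    if j = i then nbrs S T i j v
    else (if v = T j then [S j] else []) ++ ((if v = S j then [T j] else []) ++ nbrs S T i j v)

theorem mem_nbrs {S T : ℕ → ℕ} {i j v w : ℕ} :
    w ∈ nbrs S T i j v ↔ ∃ k < j, k ≠ i ∧ (S k = v ∧ T k = w ∨ T k = v ∧ S k = w) := by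
  induction j with
  | zero => simp [nbrs]
  | succ j ih =>
    rw [nbrs]
    have h : ∀ Q : ℕ → Prop, (∃ k < j + 1, Q k) ↔ Q j ∨ ∃ k < j, Q k := by
      intro Q
      simp only [Nat.lt_succ_iff_lt_or_eq]
      grind
    rw [h]
    split_ifs <;> simp_all <;> grind

theorem sum_length_nbrs_le (S T : ℕ → ℕ) (i j n : ℕ) :
    ∑ v ∈ Finset.range n, (nbrs S T i j v).length ≤ 2 * j := by
  induction j with
  | zero => simp [nbrs]
  | succ j ih =>
    have hone : ∀ a b : ℕ, ∑ v ∈ Finset.range n, (if v = a then [b] else []).length ≤ 1 := by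
      intro a b
      have : ∀ v, (if v = a then [b] else []).length = if v = a then 1 else 0 := by
        intro v; split_ifs <;> rfl
      simp only [this, Finset.sum_ite_eq']
      split_ifs <;> simp
    by_cases hj : j = i
    · simp only [nbrs, hj, if_true]
      subst hj
      omega
    · simp only [nbrs, hj, if_false, List.length_append, Finset.sum_add_distrib]
      have := hone (T j) (S j)
      have := hone (S j) (T j)
      omega

/-- The linked list that starts with the pointer `p` has the entries `l`. -/
def Chain (nxt Y : ℕ → ℕ) : ℕ → List ℕ → Prop
  | p, [] => p = 0
  | p, u :: l => 0 < p ∧ nxt p < p ∧ Y p = u ∧ Chain nxt Y (nxt p) l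

/-- Pointers strictly decrease along a list, so cells beyond `p` are irrelevant. -/
theorem Chain.congr {nxt Y nxt' Y' : ℕ → ℕ} {p : ℕ} {l : List ℕ} (h : Chain nxt Y p l)
    (hn : ∀ q ≤ p, nxt' q = nxt q) (hY : ∀ q ≤ p, Y' q = Y q) : Chain nxt' Y' p l := by
  induction l generalizing p with
  | nil => exact h
  | cons u l ih =>
    obtain ⟨h1, h2, h3, h4⟩ := h
    rw [Chain, hn p le_rfl, hY p le_rfl]
    exact ⟨h1, h2, h3, ih h4 (fun q hq => hn q (by omega)) fun q hq => hY q (by omega)⟩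

/-- For each node `v < n`, the linked list that starts with the pointer `hd v ≤ k` has the entries
`l v`. -/
def Chains (n : ℕ) (hd nxt Y : ℕ → ℕ) (k : ℕ) (l : ℕ → List ℕ) : Prop :=
  ∀ v < n, hd v ≤ k ∧ Chain nxt Y (hd v) (l v)

/-- The new cell `k + 1` lies beyond all pointers in use, so it can become the head of the list of
`a` without disturbing any list. -/
theorem Chains.push {n : ℕ} {hd nxt Y : ℕ → ℕ} {k : ℕ} {l : ℕ → List ℕ}
    (h : Chains n hd nxt Y k l) {a b : ℕ} (ha : a < n) :
    Chains n (Function.update hd a (k + 1)) (Function.update nxt (k + 1) (hd a))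
      (Function.update Y (k + 1) b) (k + 1) fun v => (if v = a then [b] else []) ++ l v := by
  intro v hv
  have hcongr : ∀ w < n, Chain (Function.update nxt (k + 1) (hd a)) (Function.update Y (k + 1) b)
      (hd w) (l w) := fun w hw => by
    have := (h w hw).1
    exact (h w hw).2.congr (fun q hq => Function.update_of_ne (by omega) _ _)
      fun q hq => Function.update_of_ne (by omega) _ _
  by_cases hva : v = a
  · subst hva
    have := (h v hv).1
    simp only [Function.update_self, if_true, List.singleton_append, le_refl, true_and, Chain]
    exact ⟨by omega, by omega, hcongr v hv⟩
  · rw [Function.update_of_ne hva]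
    simp only [hva, if_false, List.nil_append]
    exact ⟨by have := (h v hv).1; omega, hcongr v hv⟩

/-! ### Graph search -/

/-- The registers `< r` and the arrays `< a` have the same contents in both states. -/
def State.Agree (r a : ℕ) (s s' : State) : Prop :=
  (∀ x < r, s'.reg x = s.reg x) ∧ ∀ b < a, s'.arr b = s.arr b

theorem State.Agree.trans {r a : ℕ} {s s' s'' : State} (h : s.Agree r a s')
    (h' : s'.Agree r a s'') :
    s.Agree r a s'' :=
  ⟨fun x hx => (h'.1 x hx).trans (h.1 x hx), fun b hb => (h'.2 b hb).trans (h.2 b hb)⟩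

theorem State.Agree.refl (r a : ℕ) (s : State) : s.Agree r a s := ⟨fun _ _ => rfl, fun _ _ => rfl⟩

theorem State.Agree.setReg {r a : ℕ} {s s' : State} (h : s.Agree r a s') {x v : ℕ} (hx : r ≤ x) :
    s.Agree r a (s'.setReg x v) :=
  ⟨fun y hy => by rw [State.reg_setReg, if_neg (by omega), h.1 y hy], h.2⟩

theorem State.Agree.setArr {r a : ℕ} {s s' : State} (h : s.Agree r a s') {b i v : ℕ} (hb : a ≤ b) :
    s.Agree r a (s'.setArr b i v) :=
  ⟨h.1, fun c hc => by rw [State.arr_setArr, if_neg (by omega), h.2 c hc]⟩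

/-- Register `2` contains `0`, register `3` contains `1`, and the entries that a search uses are
bounded by `2 ^ L`. -/
structure State.Ready (L : ℕ) (s : State) : Prop where
  zero : s.reg 2 = 0
  one : s.reg 3 = 1
  n_lt : s.reg 0 < 2 ^ L
  m_lt : 2 * s.reg 1 < 2 ^ L

theorem State.Ready.of_agree {L r a : ℕ} {s s' : State} (h : s.Ready L) (hr : 4 ≤ r)
    (h' : s.Agree r a s') : s'.Ready L where
  zero := (h'.1 2 (by omega)).trans h.zero
  one := (h'.1 3 (by omega)).trans h.one
  n_lt := by rw [h'.1 0 (by omega)]; exact h.n_lt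
  m_lt := by rw [h'.1 1 (by omega)]; exact h.m_lt

/-- Resets the list heads (array `4`) and the visited marks (array `7`). The other work arrays may
keep old contents, since a search writes their entries before reading them. -/
def clearProg : Prog := .block [
  .const 19 0,
  .while (.lt 19 0) (.block [.store 4 19 2, .store 7 19 2, .arith .add 19 19 3])]

theorem halts_clearProg {L : ℕ} {s : State} (hs : s.Ready L) :
    Halts L clearProg s fun s' t => s.Agree 12 4 s' ∧
      (∀ v < s.reg 0, s'.arr 4 v = 0 ∧ s'.arr 7 v = 0) ∧ t ≤ 6 * s.reg 0 + 6 := by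
  apply Halts.of_vc
  have hpos : 0 < 2 ^ L := Nat.pow_pos (by norm_num)
  have h0 := hs.n_lt
  simp only [clearProg, Prog.vc_block_cons, Prog.vc_block_nil, Prog.Vc]
  refine ⟨hpos, ?_⟩
  refine (Halts.while (k := 6 * s.reg 0) (fun s' k => s.Agree 12 4 s' ∧
    (∀ v < s'.reg 19, s'.arr 4 v = 0 ∧ s'.arr 7 v = 0) ∧ s'.reg 19 ≤ s.reg 0 ∧
      6 * s.reg 0 ≤ k + 6 * s'.reg 19) ?_ ?_).imp ?_
  · rintro s' k ⟨h1, h2, h3, h4⟩ hlt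
    have h5 := hs.of_agree (by norm_num) h1
    simp only [Test.holds, h1.1 0 (by norm_num)] at hlt
    apply Halts.of_vc
    simp only [Prog.vc_block_cons, Prog.vc_block_nil, Prog.Vc, State.reg_setArr, Op.eval, h5.one]
    refine ⟨by omega, k - 6, ⟨?_, ?_, ?_, ?_⟩, ?_⟩
    · exact ((h1.setArr (by norm_num)).setArr (by norm_num)).setReg (by norm_num)
    · intro v hv
      simp only [State.reg_setReg, if_true] at hv
      simp only [State.arr_setReg, State.arr_setArr, h5.zero]
      by_cases hv' : v = s'.reg 19
      · simp [hv']
      · simp [hv', h2 v (by omega)]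
    · simp; omega
    · simp; omega
    · omega
  · refine ⟨(State.Agree.refl _ _ _).setReg (by norm_num), ?_, ?_, ?_⟩ <;> simp
  · rintro s' t ⟨h1, k, ⟨h2, h3, h4, h5⟩, h6⟩
    simp only [Test.holds, h2.1 0 (by norm_num)] at h1
    exact ⟨h2, fun v hv => h3 v (by omega), by omega⟩

/-- Adds the link with ends `a` and `b` (in registers) to the adjacency list of `a`. -/
def pushProg (a b : ℕ) : Prog := .block [
  .arith .add 18 18 3, .store 6 18 b, .load 17 4 a, .store 5 18 17, .store 4 a 18]

/-- Register `18` counts the list cells, numbered from `1` because the pointer `0` ends a list.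
Arrays `5` and `6` hold successors and entries. Each link is entered at both ends, except the one in
register `4`. -/
def buildProg : Prog := .block [
  .const 18 0, .const 19 0,
  .while (.lt 19 1) (.block [
    .ite (.eq 19 4) .skip (.block [.load 20 0 19, .load 21 1 19, pushProg 20 21, pushProg 21 20]),
    .arith .add 19 19 3])]

theorem halts_buildProg {L : ℕ} {s : State} (hs : s.Ready L)
    (hS : ∀ j < s.reg 1, s.arr 0 j < s.reg 0) (hT : ∀ j < s.reg 1, s.arr 1 j < s.reg 0)
    (hhd : ∀ v < s.reg 0, s.arr 4 v = 0) :
    Halts L buildProg s fun s' t => s.Agree 12 4 s' ∧ s'.arr 7 = s.arr 7 ∧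
      (∃ k, Chains (s.reg 0) (s'.arr 4) (s'.arr 5) (s'.arr 6) k
        (nbrs (s.arr 0) (s.arr 1) (s.reg 4) (s.reg 1))) ∧ t ≤ 20 * s.reg 1 + 20 := by
  apply Halts.of_vc
  have hpos : 0 < 2 ^ L := Nat.pow_pos (by norm_num)
  have h0 := hs.m_lt
  simp only [buildProg, Prog.vc_block_cons, Prog.vc_block_nil, Prog.Vc]
  refine ⟨hpos, hpos, ?_⟩
  refine (Halts.while (k := 20 * s.reg 1) (fun s' k => s.Agree 12 4 s' ∧ s'.arr 7 = s.arr 7 ∧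
    Chains (s.reg 0) (s'.arr 4) (s'.arr 5) (s'.arr 6) (s'.reg 18)
        (nbrs (s.arr 0) (s.arr 1) (s.reg 4) (s'.reg 19)) ∧ s'.reg 18 ≤ 2 * s'.reg 19 ∧
      s'.reg 19 ≤ s.reg 1 ∧ 20 * s.reg 1 ≤ k + 20 * s'.reg 19) ?_ ?_).imp ?_
  · rintro s' k ⟨h1, h7, h2, h8, h3, h4⟩ hlt
    have h5 := hs.of_agree (by norm_num) h1
    simp only [Test.holds, h1.1 1 (by norm_num)] at hlt
    apply Halts.of_vc
    simp only [Prog.vc_block_cons, Prog.vc_block_nil, Prog.Vc, Test.holds, Op.eval, pushProg]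
    constructor
    · intro heq
      rw [h5.one]
      refine ⟨by omega, k - 20, ⟨h1.setReg (by norm_num), h7, ?_, ?_, ?_, ?_⟩, ?_⟩
      · have : nbrs (s.arr 0) (s.arr 1) (s.reg 4) (s'.reg 19 + 1) =
            nbrs (s.arr 0) (s.arr 1) (s.reg 4) (s'.reg 19) := by
          funext v
          rw [nbrs, if_pos (by rw [heq, h1.1 4 (by norm_num)])]
        simpa [this] using h2
      · simp; omega
      · simp; omega
      · simp; omega
      · omega
    · intro hne
      have ha := hS _ hlt
      have hb := hT _ hlt
      have hpush := (h2.push ha (b := s.arr 1 (s'.reg 19))).push hb (b := s.arr 0 (s'.reg 19))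
      simp [h5.one, h1.2 0 (by norm_num), h1.2 1 (by norm_num)]
      refine ⟨by omega, by omega, by omega, k - 20, ⟨?_, h7, ?_, ?_, ?_, ?_⟩, ?_⟩
      · refine State.Agree.setReg ?_ (by norm_num)
        repeat' first
          | refine State.Agree.setReg ?_ (by norm_num)
          | refine State.Agree.setArr ?_ (by norm_num)
        exact h1
      · refine (congrArg (Chains _ _ _ _ _) (funext fun v => ?_)).mpr hpush
        rw [nbrs, if_neg (by rw [h1.1 4 (by norm_num)] at hne; exact hne)]
      · omega
      · omega
      · omega
      · omega
  · refine ⟨?_, ?_, ?_, ?_, ?_, ?_⟩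
    · exact ((State.Agree.refl _ _ _).setReg (by norm_num)).setReg (by norm_num)
    · simp
    · intro v hv
      simp [hhd v hv, nbrs, Chain]
    all_goals simp
  · rintro s' t ⟨h1, k, ⟨h2, h7, h3, h8, h4, h5⟩, h6⟩
    simp only [Test.holds, h2.1 1 (by norm_num)] at h1
    have : s'.reg 19 = s.reg 1 := by omega
    rw [this] at h3
    exact ⟨h2, h7, ⟨_, h3⟩, by omega⟩

/-- Register `14` runs through the list of the current node; unvisited neighbours are marked and
appended to the queue (array `8`, tail in register `12`). -/
def scanProg : Prog :=
  .while (.lt 2 14) (.block [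
    .load 15 6 14, .load 17 7 15,
    .ite (.eq 17 2) (.block [.store 7 15 3, .store 8 12 15, .arith .add 12 12 3]) .skip,
    .load 14 5 14])

/-- Breadth-first search from the node `0`; register `13` is the head of the queue. The final tail
is the number of nodes reached. -/
def searchProg : Prog := .block [
  .store 8 2 2, .store 7 2 3, .const 12 1, .const 13 0,
  .while (.lt 13 12) (.block [
    .load 16 8 13, .arith .add 13 13 3, .load 14 4 16, scanProg])]

/-- The nodes reached so far are the first `tail` entries of the queue `Q`, without repetitions, and
`vis` is the indicator function of the set of these nodes. -/
structure Queue (n : ℕ) (l : ℕ → List ℕ) (vis Q : ℕ → ℕ) (tail : ℕ) : Prop where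
  lt : ∀ j < tail, Q j < n
  inj : ∀ i < tail, ∀ j < tail, Q i = Q j → i = j
  vis_iff : ∀ v < n, vis v ≠ 0 ↔ ∃ j < tail, Q j = v
  reach : ∀ j < tail, Relation.ReflTransGen (fun a b => b ∈ l a) 0 (Q j)

theorem Queue.tail_le {n : ℕ} {l : ℕ → List ℕ} {vis Q : ℕ → ℕ} {tail : ℕ}
    (h : Queue n l vis Q tail) : tail ≤ n := by
  have := Finset.card_le_card_of_injOn (s := Finset.range tail) (t := Finset.range n) Q
    (fun j hj => by simpa using h.lt j (by simpa using hj))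
    (fun i hi j hj => h.inj i (by simpa using hi) j (by simpa using hj))
  simpa using this

theorem Queue.push {n : ℕ} {l : ℕ → List ℕ} {vis Q : ℕ → ℕ} {tail u j : ℕ}
    (h : Queue n l vis Q tail) (hu : u < n) (hvis : vis u = 0) (hj : j < tail) (hul : u ∈ l (Q j)) :
    Queue n l (Function.update vis u 1) (Function.update Q tail u) (tail + 1) := by
  have hQ : ∀ i < tail, Function.update Q tail u i = Q i := fun i hi =>
    Function.update_of_ne (by omega) _ _
  have hnew : ∀ i < tail, Q i ≠ u := fun i hi hiu =>
    absurd hvis ((h.vis_iff u hu).2 ⟨i, hi, hiu⟩)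
  have hcases : ∀ i, i < tail + 1 → i < tail ∨ i = tail := fun i hi => by omega
  constructor
  · intro i hi
    rcases hcases i hi with hi | rfl
    · rw [hQ i hi]; exact h.lt i hi
    · simpa using hu
  · intro i hi k hk hik
    rcases hcases i hi with hi | rfl <;> rcases hcases k hk with hk | rfl
    · rw [hQ i hi, hQ k hk] at hik
      exact h.inj i hi k hk hik
    · rw [hQ i hi, Function.update_self] at hik
      exact absurd hik (hnew i hi)
    · rw [hQ k hk, Function.update_self] at hik
      exact absurd hik.symm (hnew k hk)
    · rfl
  · intro v hv
    by_cases hvu : v = u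
    · subst hvu
      simp only [Function.update_self, ne_eq, one_ne_zero, not_false_eq_true, true_iff]
      exact ⟨tail, by omega, by simp⟩
    · rw [Function.update_of_ne hvu, h.vis_iff v hv]
      constructor
      · rintro ⟨i, hi, rfl⟩
        exact ⟨i, by omega, hQ i hi⟩
      · rintro ⟨i, hi, hiv⟩
        rcases hcases i hi with hi | rfl
        · exact ⟨i, hi, by rw [← hiv, hQ i hi]⟩
        · rw [Function.update_self] at hiv
          exact absurd hiv.symm hvu
  · intro i hi
    rcases hcases i hi with hi | rfl
    · rw [hQ i hi]; exact h.reach i hi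
    · rw [Function.update_self]
      exact (h.reach j hj).tail hul

theorem halts_scanProg {L n : ℕ} {l : ℕ → List ℕ} {s : State} (hs : s.Ready L)
    (hn : s.reg 0 = n) (hl : ∀ v < n, ∀ u ∈ l v, u < n) {j : ℕ} (hj : j < s.reg 12)
    (hq : Queue n l (s.arr 7) (s.arr 8) (s.reg 12))
    (hc : Chain (s.arr 5) (s.arr 6) (s.reg 14) (l (s.arr 8 j))) :
    Halts L scanProg s fun s' t => s.Agree 12 7 s' ∧ s'.reg 13 = s.reg 13 ∧
      Queue n l (s'.arr 7) (s'.arr 8) (s'.reg 12) ∧ s.reg 12 ≤ s'.reg 12 ∧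
      (∀ i < s.reg 12, s'.arr 8 i = s.arr 8 i) ∧
      (∀ u ∈ l (s.arr 8 j), s'.arr 7 u ≠ 0) ∧
      (∀ u < n, s.arr 7 u ≠ 0 → s'.arr 7 u ≠ 0) ∧ t ≤ 12 * (l (s.arr 8 j)).length + 1 := by
  have hpos : 0 < 2 ^ L := Nat.pow_pos (by norm_num)
  have h0 := hs.n_lt
  -- The list `r` is the unread rest: each neighbour is marked already or still in `r`.
  refine (Halts.while (k := 12 * (l (s.arr 8 j)).length) (fun s' k => s.Agree 12 7 s' ∧
      s'.reg 13 = s.reg 13 ∧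
      Queue n l (s'.arr 7) (s'.arr 8) (s'.reg 12) ∧ s.reg 12 ≤ s'.reg 12 ∧
      (∀ i < s.reg 12, s'.arr 8 i = s.arr 8 i) ∧
      (∀ u < n, s.arr 7 u ≠ 0 → s'.arr 7 u ≠ 0) ∧
      ∃ r, Chain (s.arr 5) (s.arr 6) (s'.reg 14) r ∧ (∀ u ∈ r, u ∈ l (s.arr 8 j)) ∧
        (∀ u ∈ l (s.arr 8 j), s'.arr 7 u ≠ 0 ∨ u ∈ r) ∧ 12 * r.length ≤ k) ?_ ?_).imp ?_
  · rintro s' k ⟨h1, h2, h3, h4, h5, h6, r, hr, h7, h8, h9⟩ hlt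
    have hr' := hs.of_agree (by norm_num) h1
    simp only [Test.holds, hr'.zero] at hlt
    cases r with
    | nil => exact absurd hr hlt.ne'
    | cons u r =>
    obtain ⟨-, -, hu, hr⟩ := hr
    have hul := h7 u (by simp)
    have hun := hl _ (hq.lt j hj) u hul
    have htail := h3.tail_le
    simp only [List.length_cons] at h9
    apply Halts.of_vc
    simp only [Prog.vc_block_cons, Prog.vc_block_nil, Prog.Vc, Test.holds, Op.eval]
    simp [hr'.one, hr'.zero, h1.2 6 (by norm_num), h1.2 5 (by norm_num), hu]
    constructor
    · intro hvis
      have hpush := h3.push hun hvis (j := j) (by omega) (by rw [h5 j hj]; exact hul)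
      have htail' := hpush.tail_le
      refine ⟨by omega, k - 12, ⟨?_, h2, hpush, by omega, ?_, ?_, r, hr, ?_, ?_, by omega⟩,
        by omega⟩
      · repeat' first
          | refine State.Agree.setReg ?_ (by norm_num)
          | refine State.Agree.setArr ?_ (by norm_num)
        exact h1
      · intro i hi
        rw [Function.update_of_ne (by omega), h5 i hi]
      · intro w hw hws
        rw [Function.update_apply]
        split_ifs
        exacts [not_false, h6 w hw hws]
      · exact fun w hw => h7 w (by simp [hw])
      · intro w hw
        rw [Function.update_apply]
        split_ifs with hwu
        · simp
        · simpa [hwu] using h8 w hw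
    · intro hvis
      refine ⟨k - 12, ⟨?_, h2, h3, h4, h5, h6, r, hr, ?_, ?_, by omega⟩, by omega⟩
      · repeat' first
          | refine State.Agree.setReg ?_ (by norm_num)
          | refine State.Agree.setArr ?_ (by norm_num)
        exact h1
      · exact fun w hw => h7 w (by simp [hw])
      · intro w hw
        by_cases hwu : w = u
        · exact Or.inl (hwu ▸ hvis)
        · simpa [hwu] using h8 w hw
  · exact ⟨State.Agree.refl _ _ _, rfl, hq, le_rfl, fun _ _ => rfl, fun _ _ h => h, _, hc,
      fun _ h => h, fun _ h => Or.inr h, le_rfl⟩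
  · rintro s' t ⟨h1, k, ⟨h2, h3, h4, h5, h6, h7, r, hr, -, h8, h9⟩, h10⟩
    have hz : s'.reg 14 = 0 := by
      simpa [Test.holds, (hs.of_agree (by norm_num) h2).zero] using h1
    cases r with
    | nil => exact ⟨h2, h3, h4, h5, h6, fun u hu => by simpa using h8 u hu, h7, by omega⟩
    | cons u r => exact absurd hr.1 (by omega)

theorem halts_searchProg {L n : ℕ} {l : ℕ → List ℕ} {s : State} (hs : s.Ready L)
    (hn : s.reg 0 = n) (hn0 : 0 < n) (hl : ∀ v < n, ∀ u ∈ l v, u < n)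
    (hvis : ∀ v < n, s.arr 7 v = 0) {k : ℕ}
    (hc : Chains n (s.arr 4) (s.arr 5) (s.arr 6) k l) :
    Halts L searchProg s fun s' t => s.Agree 12 4 s' ∧
      (s'.reg 12 = n ↔ ∀ v < n, Relation.ReflTransGen (fun a b => b ∈ l a) 0 v) ∧
      s'.reg 12 ≤ n ∧
      t ≤ 12 * ∑ v ∈ Finset.range n, (l v).length + 12 * n + 12 := by
  apply Halts.of_vc
  have hpos : 0 < 2 ^ L := Nat.pow_pos (by norm_num)
  have h0 := hs.n_lt
  simp only [searchProg, Prog.vc_block_cons, Prog.vc_block_nil, Prog.Vc]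
  refine ⟨by omega, hpos, ?_⟩
  -- Amortised budget: queue entries are distinct, so each node pays once for being dequeued and for
  -- the scan of its list.
  set B := ∑ v ∈ Finset.range n, (12 * (l v).length + 12) with hB
  have hBe : B = 12 * ∑ v ∈ Finset.range n, (l v).length + 12 * n := by
    rw [hB, Finset.sum_add_distrib, Finset.mul_sum]
    simp [mul_comm]
  refine (Halts.while (k := B) (fun s' k => s.Agree 12 7 s' ∧
      Queue n l (s'.arr 7) (s'.arr 8) (s'.reg 12) ∧ s'.reg 13 ≤ s'.reg 12 ∧ 0 < s'.reg 12 ∧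
      s'.arr 8 0 = 0 ∧
      (∀ j < s'.reg 13, ∀ u ∈ l (s'.arr 8 j), s'.arr 7 u ≠ 0) ∧
      B ≤ k + ∑ j ∈ Finset.range (s'.reg 13), (12 * (l (s'.arr 8 j)).length + 12)) ?_ ?_).imp ?_
  · rintro s' k' ⟨h1, h2, h3, h4, h5, h6, h7⟩ hlt
    have hr' := hs.of_agree (by norm_num) h1
    simp only [Test.holds] at hlt
    have htail := h2.tail_le
    have hv := h2.lt _ hlt
    apply Halts.block_cons
    apply Halts.of_vc
    simp only [Prog.Vc]
    apply Halts.block_cons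
    apply Halts.of_vc
    simp only [Prog.Vc]
    refine ⟨by simp [Op.eval, hr'.one]; omega, ?_⟩
    apply Halts.block_cons
    apply Halts.of_vc
    simp only [Prog.Vc]
    apply Halts.block_cons
    have hagree : ∀ {x y z : ℕ}, s.Agree 12 7 (((s'.setReg 16 x).setReg 13 y).setReg 14 z) := by
      intros
      repeat' first
        | refine State.Agree.setReg ?_ (by norm_num)
        | refine State.Agree.setArr ?_ (by norm_num)
      exact h1
    refine (halts_scanProg (n := n) (l := l) (j := s'.reg 13)
      (hs.of_agree (by norm_num) hagree)
      ?_ hl ?_ ?_ ?_).imp ?_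
    · simpa [h1.1 0 (by norm_num)] using hn
    · simpa using hlt
    · simpa using h2
    · simpa [h1.2 4 (by norm_num), h1.2 5 (by norm_num), h1.2 6 (by norm_num)] using (hc _ hv).2
    · rintro s'' t ⟨g1, g2, g3, g4, g5, g6, g7, g8⟩
      simp [Op.eval, hr'.one] at g2 g4 g5 g6 g7 g8
      apply Halts.of_vc
      simp only [Prog.vc_block_nil]
      have hsum : ∑ j ∈ Finset.range (s'.reg 13 + 1), (12 * (l (s'.arr 8 j)).length + 12) ≤ B := by
        rw [hB, ← Finset.sum_image (s := Finset.range (s'.reg 13 + 1)) (g := s'.arr 8)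
          (f := fun v => 12 * (l v).length + 12)]
        · refine Finset.sum_le_sum_of_subset fun v hv => ?_
          obtain ⟨j, hj, rfl⟩ := Finset.mem_image.1 hv
          rw [Finset.mem_range] at hj ⊢
          exact h2.lt j (by omega)
        · intro i hi j hj
          simp only [Finset.coe_range, Set.mem_Iio] at hi hj
          exact h2.inj i (by omega) j (by omega)
      have hsum' : ∑ j ∈ Finset.range (s'.reg 13 + 1), (12 * (l (s''.arr 8 j)).length + 12) =
          ∑ j ∈ Finset.range (s'.reg 13 + 1), (12 * (l (s'.arr 8 j)).length + 12) := by
        refine Finset.sum_congr rfl fun j hj => ?_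
        rw [g5 j (by rw [Finset.mem_range] at hj; omega)]
      rw [Finset.sum_range_succ] at hsum
      refine ⟨k' - (12 * (l (s'.arr 8 (s'.reg 13))).length + 12), ⟨hagree.trans g1, g3,
        by omega, by omega, by rw [g5 0 h4, h5], ?_, ?_⟩, by omega⟩
      · intro j hj u hu
        rw [g2] at hj
        rw [g5 j (by omega)] at hu
        rcases Nat.lt_succ_iff_lt_or_eq.1 hj with hj' | rfl
        · exact g7 u (hl _ (h2.lt j (by omega)) u hu) (h6 j hj' u hu)
        · exact g6 u hu
      · rw [g2, hsum', Finset.sum_range_succ]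
        omega
  · refine ⟨?_, ⟨?_, ?_, ?_, ?_⟩, ?_, ?_, ?_, ?_, ?_⟩
    · repeat' first
        | refine State.Agree.setReg ?_ (by norm_num)
        | refine State.Agree.setArr ?_ (by norm_num)
      exact State.Agree.refl _ _ _
    · simpa [hs.zero] using hn0
    · simp
    · intro v hv
      simp only [State.arr_setReg, State.arr_setArr, State.reg_setArr, State.reg_setReg, hs.zero,
        hs.one]
      by_cases hv0 : v = 0
      · simp [hv0]
      · simpa [hv0, hvis v hv] using Ne.symm hv0
    · simp [hs.zero, Relation.ReflTransGen.refl]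
    · simp
    · simp
    · simp [hs.zero]
    · simp
    · simp
  · rintro s' t ⟨h1, k', ⟨h2, h3, h4, h5, h6, h7, h8⟩, h9⟩
    simp only [Test.holds] at h1
    have htail := h3.tail_le
    have h13 : s'.reg 13 = s'.reg 12 := by omega
    refine ⟨⟨fun x hx => h2.1 x hx, fun b hb => h2.2 b (by omega)⟩, ⟨fun h v hv => ?_, fun h => ?_⟩,
      htail, by omega⟩
    -- Distinct entries, as many as there are nodes: the queue contains every node, and all entries
    -- are reachable.
    · have himg : (Finset.range (s'.reg 12)).image (s'.arr 8) = Finset.range n := by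
        refine Finset.eq_of_subset_of_card_le (fun w hw => ?_) ?_
        · obtain ⟨j, hj, rfl⟩ := Finset.mem_image.1 hw
          exact Finset.mem_range.2 (h3.lt j (Finset.mem_range.1 hj))
        · rw [Finset.card_image_of_injOn, Finset.card_range, Finset.card_range, h]
          intro i hi j hj
          simp only [Finset.coe_range, Set.mem_Iio] at hi hj
          exact h3.inj i hi j hj
      have : v ∈ (Finset.range (s'.reg 12)).image (s'.arr 8) := himg ▸ Finset.mem_range.2 hv
      obtain ⟨j, hj, rfl⟩ := Finset.mem_image.1 this
      exact h3.reach j (Finset.mem_range.1 hj)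
    -- Once every entry has been scanned, the queue is closed under taking neighbours.
    · have hall : ∀ v, Relation.ReflTransGen (fun a b => b ∈ l a) 0 v →
          ∃ j < s'.reg 12, s'.arr 8 j = v := by
        intro v hv
        induction hv with
        | refl => exact ⟨0, h5, h6⟩
        | tail _ hbc ih =>
          obtain ⟨j, hj, rfl⟩ := ih
          exact (h3.vis_iff _ (hl _ (h3.lt j hj) _ hbc)).1 (h7 j (by omega) _ hbc)
      have := Finset.card_le_card_of_surjOn (s := Finset.range (s'.reg 12)) (t := Finset.range n)
        (s'.arr 8) (fun v hv => by
          obtain ⟨j, hj, rfl⟩ := hall v (h v (by simpa using hv))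
          exact ⟨j, by simpa using hj, rfl⟩)
      simp only [Finset.card_range] at this
      omega

/-- Counts the nodes that are reachable from the node `0` without the link in register `4`. -/
def reachProg : Prog := .block [clearProg, buildProg, searchProg]

theorem halts_reachProg {L : ℕ} {s : State} (hs : s.Ready L) (hn : 0 < s.reg 0)
    (hS : ∀ j < s.reg 1, s.arr 0 j < s.reg 0) (hT : ∀ j < s.reg 1, s.arr 1 j < s.reg 0) :
    Halts L reachProg s fun s' t => s.Agree 12 4 s' ∧
      (s'.reg 12 = s.reg 0 ↔ ∀ v < s.reg 0, Relation.ReflTransGen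
        (fun a b => b ∈ nbrs (s.arr 0) (s.arr 1) (s.reg 4) (s.reg 1) a) 0 v) ∧
      s'.reg 12 ≤ s.reg 0 ∧ t ≤ 44 * (s.reg 0 + s.reg 1 + 1) := by
  apply Halts.block_cons
  refine (halts_clearProg hs).imp ?_
  rintro s₁ t₁ ⟨a1, c1, ht1⟩
  have hs1 := hs.of_agree (by norm_num) a1
  have e0 := a1.1 0 (by norm_num)
  have e1 := a1.1 1 (by norm_num)
  have e4 := a1.1 4 (by norm_num)
  have e0' := a1.2 0 (by norm_num)
  have e1' := a1.2 1 (by norm_num)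
  apply Halts.block_cons
  refine (halts_buildProg hs1 (by rwa [e0, e1, e0']) (by rwa [e0, e1, e1']) ?_).imp ?_
  · rw [e0]
    exact fun v hv => (c1 v hv).1
  rintro s₂ t₂ ⟨a2, h7, ⟨k, hk⟩, ht2⟩
  rw [e0, e1, e4, e0', e1'] at hk
  rw [e1] at ht2
  have hs2 := hs1.of_agree (by norm_num) a2
  apply Halts.block_cons
  refine (halts_searchProg hs2 (n := s.reg 0) ((a2.1 0 (by norm_num)).trans e0) hn ?_ ?_ hk).imp ?_
  · intro v hv u hu
    rw [mem_nbrs] at hu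
    obtain ⟨j, hj, -, ⟨-, rfl⟩ | ⟨-, rfl⟩⟩ := hu
    exacts [hT j hj, hS j hj]
  · intro v hv
    rw [h7]
    exact (c1 v hv).2
  rintro s₃ t₃ ⟨a3, h3, hle, ht3⟩
  apply Halts.of_vc
  rw [Prog.vc_block_nil]
  have := sum_length_nbrs_le (s.arr 0) (s.arr 1) (s.reg 4) (s.reg 1) (s.reg 0)
  exact ⟨(a1.trans a2).trans a3, h3, hle, by omega⟩

/-! ### The program -/

/-- The conditions on the input arrays that the program relies on, for numbers with `L` digits. -/
structure Admissible (L n m : ℕ) (a : ℕ → ℕ → ℕ) : Prop where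
  n_pos : 0 < n
  n_lt : n < 2 ^ L
  m_lt : 2 * m + 1 < 2 ^ L
  src_lt : ∀ j < m, a 0 j < n
  tgt_lt : ∀ j < m, a 1 j < n
  le_den : ∀ j < m, a 2 j ≤ a 3 j
  den_pos : ∀ j < m, 0 < a 3 j
  prod_lt : (m + 1) * ∏ j ∈ Finset.range m, a 3 j < 2 ^ L

/-- The constants and the input are in their places. -/
structure State.Loaded (n m : ℕ) (a : ℕ → ℕ → ℕ) (s : State) : Prop where
  n_eq : s.reg 0 = n
  m_eq : s.reg 1 = m
  zero : s.reg 2 = 0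
  one : s.reg 3 = 1
  arr_eq : ∀ b < 4, s.arr b = a b

theorem State.Loaded.of_agree {n m : ℕ} {a : ℕ → ℕ → ℕ} {r : ℕ} {s s' : State}
    (h : s.Loaded n m a) (hr : 4 ≤ r) (h' : s.Agree r 4 s') : s'.Loaded n m a where
  n_eq := (h'.1 0 (by omega)).trans h.n_eq
  m_eq := (h'.1 1 (by omega)).trans h.m_eq
  zero := (h'.1 2 (by omega)).trans h.zero
  one := (h'.1 3 (by omega)).trans h.one
  arr_eq b hb := (h'.2 b hb).trans (h.arr_eq b hb)

theorem State.Loaded.ready {L n m : ℕ} {a : ℕ → ℕ → ℕ} {s : State} (h : s.Loaded n m a)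
    (ha : Admissible L n m a) : s.Ready L where
  zero := h.zero
  one := h.one
  n_lt := h.n_eq ▸ ha.n_lt
  m_lt := by have := ha.m_lt; rw [h.m_eq]; omega

/-- All nodes are reachable from the node `0` without the link `i`. -/
def Spans (n m : ℕ) (a : ℕ → ℕ → ℕ) (i : ℕ) : Prop :=
  ∀ v < n, Relation.ReflTransGen (fun x y => y ∈ nbrs (a 0) (a 1) i m x) 0 v

/-- The numerator of the factor of the link `j` in the probability that exactly the link `i` is
down. -/
def factor (a : ℕ → ℕ → ℕ) (i j : ℕ) : ℕ := if j = i then a 3 j - a 2 j else a 2 j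

theorem Admissible.prod_factor_le {L n m : ℕ} {a : ℕ → ℕ → ℕ} (ha : Admissible L n m a) (i : ℕ)
    {k : ℕ} (hk : k ≤ m) :
    ∏ j ∈ Finset.range k, factor a i j ≤ ∏ j ∈ Finset.range m, a 3 j := by
  calc ∏ j ∈ Finset.range k, factor a i j ≤ ∏ j ∈ Finset.range k, a 3 j := by
        refine Finset.prod_le_prod' fun j hj => ?_
        have := ha.le_den j (by rw [Finset.mem_range] at hj; omega)
        rw [factor]
        split_ifs <;> omega
    _ ≤ ∏ j ∈ Finset.range m, a 3 j :=
        Finset.prod_le_prod_of_subset_of_one_le' (Finset.range_mono hk) fun j hj _ =>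
          ha.den_pos j (Finset.mem_range.1 hj)

theorem Admissible.prod_den_lt {L n m : ℕ} {a : ℕ → ℕ → ℕ} (ha : Admissible L n m a)
    {k : ℕ} (hk : k ≤ m) : ∏ j ∈ Finset.range k, a 3 j < 2 ^ L := by
  have h1 : ∏ j ∈ Finset.range k, a 3 j ≤ ∏ j ∈ Finset.range m, a 3 j :=
    Finset.prod_le_prod_of_subset_of_one_le' (Finset.range_mono hk) fun j hj _ =>
      ha.den_pos j (Finset.mem_range.1 hj)
  have h2 := ha.prod_lt
  have h3 := Nat.le_mul_of_pos_left (∏ j ∈ Finset.range m, a 3 j) (Nat.succ_pos m)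
  simp only [Nat.succ_eq_add_one] at h3
  omega

/-- The link in register `4` contributes `den - num`, all others `num`. The value `m` there means
that no link is down. -/
def prodProg : Prog := .block [
  .const 7 1, .const 8 0,
  .while (.lt 8 1) (.block [
    .load 9 2 8, .load 10 3 8, .ite (.eq 8 4) (.arith .sub 9 10 9) .skip,
    .arith .mul 7 7 9, .arith .add 8 8 3])]

theorem halts_prodProg {L n m : ℕ} {a : ℕ → ℕ → ℕ} (ha : Admissible L n m a) {s : State}
    (hs : s.Loaded n m a) :
    Halts L prodProg s fun s' t => s.Agree 7 4 s' ∧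
      s'.reg 7 = ∏ j ∈ Finset.range m, factor a (s.reg 4) j ∧ t ≤ 10 * m + 10 := by
  apply Halts.of_vc
  have hm := ha.m_lt
  simp only [prodProg, Prog.vc_block_cons, Prog.vc_block_nil, Prog.Vc]
  refine ⟨by omega, by omega, ?_⟩
  refine (Halts.while (k := 10 * m) (fun s' k => s.Agree 7 4 s' ∧
    s'.reg 7 = ∏ j ∈ Finset.range (s'.reg 8), factor a (s.reg 4) j ∧ s'.reg 8 ≤ m ∧
      10 * m ≤ k + 10 * s'.reg 8) ?_ ?_).imp ?_
  · rintro s' k ⟨h1, h2, h3, h4⟩ hlt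
    have h5 := hs.of_agree (by norm_num) h1
    simp only [Test.holds, h5.m_eq] at hlt
    apply Halts.of_vc
    have hfac := ha.prod_factor_le (s.reg 4) (k := s'.reg 8 + 1) (by omega)
    have hlt' := ha.prod_den_lt le_rfl
    have hD : a 3 (s'.reg 8) < 2 ^ L := by
      refine lt_of_le_of_lt ?_ hlt'
      exact Finset.single_le_prod' (f := a 3) (fun j hj => ha.den_pos j (Finset.mem_range.1 hj))
        (Finset.mem_range.2 hlt)
    have e4 := h1.1 4 (by norm_num)
    simp only [Prog.vc_block_cons, Prog.vc_block_nil, Prog.Vc, Test.holds, Op.eval]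
    simp only [State.reg_setReg, State.arr_setReg, h5.arr_eq 2 (by norm_num),
      h5.arr_eq 3 (by norm_num), e4, h5.one, h2]
    rw [Finset.prod_range_succ] at hfac
    constructor
    · intro heq
      simp at heq
      have hf : factor a (s.reg 4) (s'.reg 8) = a 3 (s'.reg 8) - a 2 (s'.reg 8) := by
        simp [factor, heq]
      rw [hf] at hfac
      simp
      refine ⟨by omega, by omega, by omega, k - 10, ⟨?_, ?_, by omega, by omega⟩, by omega⟩
      · repeat' first
          | refine State.Agree.setReg ?_ (by norm_num)
        exact h1
      · rw [Finset.prod_range_succ, hf]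
    · intro heq
      simp at heq
      have hf : factor a (s.reg 4) (s'.reg 8) = a 2 (s'.reg 8) := by
        simp [factor, heq]
      rw [hf] at hfac
      simp
      refine ⟨by omega, by omega, k - 10, ⟨?_, ?_, by omega, by omega⟩, by omega⟩
      · repeat' first
          | refine State.Agree.setReg ?_ (by norm_num)
        exact h1
      · rw [Finset.prod_range_succ, hf]
  · refine ⟨?_, ?_, ?_, ?_⟩
    · exact ((State.Agree.refl _ _ _).setReg (by norm_num)).setReg (by norm_num)
    all_goals simp
  · rintro s' t ⟨h1, k, ⟨h2, h3, h4, h5⟩, h6⟩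
    simp only [Test.holds, (hs.of_agree (by norm_num) h2).m_eq] at h1
    have : s'.reg 8 = m := by omega
    rw [this] at h3
    exact ⟨h2, h3, by omega⟩

def denProg : Prog := .block [
  .const 6 1, .const 8 0,
  .while (.lt 8 1) (.block [.load 9 3 8, .arith .mul 6 6 9, .arith .add 8 8 3])]

theorem halts_denProg {L n m : ℕ} {a : ℕ → ℕ → ℕ} (ha : Admissible L n m a) {s : State}
    (hs : s.Loaded n m a) :
    Halts L denProg s fun s' t => s.Agree 6 4 s' ∧
      s'.reg 6 = ∏ j ∈ Finset.range m, a 3 j ∧ t ≤ 10 * m + 10 := by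
  apply Halts.of_vc
  have hm := ha.m_lt
  simp only [denProg, Prog.vc_block_cons, Prog.vc_block_nil, Prog.Vc]
  refine ⟨by omega, by omega, ?_⟩
  refine (Halts.while (k := 10 * m) (fun s' k => s.Agree 6 4 s' ∧
    s'.reg 6 = ∏ j ∈ Finset.range (s'.reg 8), a 3 j ∧ s'.reg 8 ≤ m ∧
      10 * m ≤ k + 10 * s'.reg 8) ?_ ?_).imp ?_
  · rintro s' k ⟨h1, h2, h3, h4⟩ hlt
    have h5 := hs.of_agree (by norm_num) h1
    simp only [Test.holds, h5.m_eq] at hlt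
    apply Halts.of_vc
    have hden := ha.prod_den_lt (k := s'.reg 8 + 1) (by omega)
    simp only [Prog.vc_block_cons, Prog.vc_block_nil, Prog.Vc, Op.eval]
    rw [Finset.prod_range_succ] at hden
    simp [h5.arr_eq 3 (by norm_num), h5.one, h2]
    refine ⟨by omega, by omega, k - 10, ⟨?_, ?_, by omega, by omega⟩, by omega⟩
    · repeat' first
        | refine State.Agree.setReg ?_ (by norm_num)
      exact h1
    · rw [Finset.prod_range_succ]
  · refine ⟨?_, ?_, ?_, ?_⟩
    · exact ((State.Agree.refl _ _ _).setReg (by norm_num)).setReg (by norm_num)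
    all_goals simp
  · rintro s' t ⟨h1, k, ⟨h2, h3, h4, h5⟩, h6⟩
    simp only [Test.holds, (hs.of_agree (by norm_num) h2).m_eq] at h1
    have : s'.reg 8 = m := by omega
    rw [this] at h3
    exact ⟨h2, h3, by omega⟩

theorem halts_reachProg' {L n m : ℕ} {a : ℕ → ℕ → ℕ} (ha : Admissible L n m a) {s : State}
    (hs : s.Loaded n m a) :
    Halts L reachProg s fun s' t => s.Agree 12 4 s' ∧
      (s'.reg 12 < n ↔ ¬ Spans n m a (s.reg 4)) ∧ t ≤ 44 * (n + m + 1) := by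
  have e0 := hs.arr_eq 0 (by norm_num)
  have e1 := hs.arr_eq 1 (by norm_num)
  refine (halts_reachProg (hs.ready ha) (hs.n_eq ▸ ha.n_pos) ?_ ?_).imp ?_
  · rw [e0, hs.n_eq, hs.m_eq]; exact ha.src_lt
  · rw [e1, hs.n_eq, hs.m_eq]; exact ha.tgt_lt
  · rintro s' t ⟨h1, h2, h3, h4⟩
    rw [e0, e1, hs.n_eq, hs.m_eq] at h2
    rw [hs.n_eq] at h3
    rw [hs.n_eq, hs.m_eq] at h4
    refine ⟨h1, ?_, h4⟩
    rw [Spans, ← h2]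
    omega

/-- Tries each link as the failing one and adds its product to register `5` when the search still
reaches all nodes. -/
def addStatesProg : Prog :=
  .while (.lt 4 1) (.block [
    reachProg, .ite (.lt 12 0) .skip (.block [prodProg, .arith .add 5 5 7]), .arith .add 4 4 3])

open scoped Classical in
/-- The numerator of the total probability of the connected states with exactly one link down, which
is one of the first `k` links. -/
noncomputable def oneDown (n m : ℕ) (a : ℕ → ℕ → ℕ) (k : ℕ) : ℕ :=
  ∑ i ∈ Finset.range k, if Spans n m a i then ∏ j ∈ Finset.range m, factor a i j else 0

theorem Admissible.oneDown_le {L n m : ℕ} {a : ℕ → ℕ → ℕ} (ha : Admissible L n m a) (k : ℕ) :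
    oneDown n m a k ≤ k * ∏ j ∈ Finset.range m, a 3 j := by
  rw [oneDown]
  refine (Finset.sum_le_card_nsmul _ _ (∏ j ∈ Finset.range m, a 3 j) fun i _ => ?_).trans (by simp)
  split_ifs
  exacts [ha.prod_factor_le i le_rfl, Nat.zero_le _]

theorem halts_addStatesProg {L n m : ℕ} {a : ℕ → ℕ → ℕ} (ha : Admissible L n m a) {s : State}
    (hs : s.Loaded n m a) (h4 : s.reg 4 = 0)
    (h5 : s.reg 5 ≤ ∏ j ∈ Finset.range m, a 3 j) :
    Halts L addStatesProg s fun s' t => s'.Loaded n m a ∧ s'.reg 6 = s.reg 6 ∧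
      s'.reg 5 = s.reg 5 + oneDown n m a m ∧ t ≤ 70 * (n + m + 1) * m + 1 := by
  -- One round costs a search, `44 * (n + m + 1)`, a product, `10 * m + 10`, and a few single
  -- operations.
  set K := 70 * (n + m + 1) with hK
  refine (Halts.while (k := K * m) (fun s' k => s'.Loaded n m a ∧ s'.reg 6 = s.reg 6 ∧
    s'.reg 5 = s.reg 5 + oneDown n m a (s'.reg 4) ∧ s'.reg 4 ≤ m ∧
      K * m ≤ k + K * s'.reg 4) ?_ ?_).imp ?_
  · rintro s' k ⟨g1, g2, g3, g4, g5⟩ hlt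
    simp only [Test.holds, g1.m_eq] at hlt
    have hm := ha.m_lt
    have hKk : K ≤ k := by
      have : K * (s'.reg 4 + 1) ≤ K * m := Nat.mul_le_mul_left _ hlt
      rw [Nat.mul_succ] at this
      omega
    have hKm : K * (s'.reg 4 + 1) = K * s'.reg 4 + K := Nat.mul_succ _ _
    apply Halts.block_cons
    refine (halts_reachProg' ha g1).imp ?_
    rintro s₁ t₁ ⟨a1, c1, ht1⟩
    have l1 := g1.of_agree (by norm_num) a1
    have e4 := a1.1 4 (by norm_num)
    have e5 := a1.1 5 (by norm_num)
    have e6 := a1.1 6 (by norm_num)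
    apply Halts.block_cons
    have hlast : ∀ (s₂ : State) (t₂ : ℕ), s₂.Loaded n m a → s₂.reg 4 = s'.reg 4 →
        s₂.reg 6 = s.reg 6 → s₂.reg 5 = s.reg 5 + oneDown n m a (s'.reg 4 + 1) →
        t₂ ≤ 10 * m + 15 → Halts L (.block [.arith .add 4 4 3]) s₂ fun s'' t' =>
          ∃ k', (s''.Loaded n m a ∧ s''.reg 6 = s.reg 6 ∧
            s''.reg 5 = s.reg 5 + oneDown n m a (s''.reg 4) ∧ s''.reg 4 ≤ m ∧
            K * m ≤ k' + K * s''.reg 4) ∧ t₁ + (t₂ + t') + k' + 1 ≤ k := by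
      intro s₂ t₂ l b4 b6 b5 bt
      apply Halts.of_vc
      simp only [Prog.vc_block_cons, Prog.vc_block_nil, Prog.Vc, Op.eval, l.one, b4]
      refine ⟨by omega, k - K, ⟨l.of_agree (r := 4) le_rfl
        ((State.Agree.refl _ _ _).setReg le_rfl), by simpa using b6, by simpa using b5, ?_, ?_⟩, ?_⟩
      · simp; omega
      · simp; omega
      · have := ha.n_pos
        omega
    apply Halts.ite
    · intro hb
      simp only [Test.holds, l1.n_eq] at hb
      apply Halts.of_vc
      simp only [Prog.Vc]
      refine (hlast s₁ 2 l1 e4 (e6.trans g2) ?_ (by omega)).imp ?_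
      · rw [e5, g3, oneDown, oneDown, Finset.sum_range_succ, if_neg (c1.1 hb), add_zero]
      · rintro s'' t' ⟨k', h, h'⟩
        exact ⟨k', h, by omega⟩
    · intro hb
      simp only [Test.holds, l1.n_eq, c1, not_not] at hb
      apply Halts.block_cons
      refine (halts_prodProg ha l1).imp ?_
      rintro s₂ t₂ ⟨a2, c2, ht2⟩
      have l2 := l1.of_agree (by norm_num) a2
      have hsum : s₂.reg 5 + s₂.reg 7 = s.reg 5 + oneDown n m a (s'.reg 4 + 1) := by
        rw [a2.1 5 (by norm_num), e5, g3, c2, oneDown, oneDown, Finset.sum_range_succ, if_pos hb,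
          e4, add_assoc]
      have hle : s.reg 5 + oneDown n m a (s'.reg 4 + 1) < 2 ^ L := by
        have h1 := ha.oneDown_le (s'.reg 4 + 1)
        have h2 : (s'.reg 4 + 1) * ∏ j ∈ Finset.range m, a 3 j ≤ m * ∏ j ∈ Finset.range m, a 3 j :=
          Nat.mul_le_mul_right _ hlt
        have h3 := ha.prod_lt
        rw [Nat.succ_mul] at h3
        omega
      apply Halts.of_vc
      simp only [Prog.vc_block_cons, Prog.vc_block_nil, Prog.Vc, Op.eval]
      rw [hsum]
      refine ⟨hle, ?_⟩
      refine (hlast _ (1 + (t₂ + (1 + 1))) (l2.of_agree (r := 4) le_rfl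
        ((State.Agree.refl _ _ _).setReg (by norm_num))) ?_ ?_ ?_ (by omega)).imp ?_
      · simpa using (a2.1 4 (by norm_num)).trans e4
      · simpa using ((a2.1 6 (by norm_num)).trans e6).trans g2
      · simp
      · rintro s'' t' ⟨k', h, h'⟩
        exact ⟨k', h, by omega⟩
  · exact ⟨hs, rfl, by simp [h4, oneDown], by omega, by omega⟩
  · rintro s' t ⟨h1, k, ⟨h2, h3, h4, h5, h6⟩, h7⟩
    simp only [Test.holds, h2.m_eq] at h1
    have : s'.reg 4 = m := by omega
    rw [this] at h4
    exact ⟨h2, h3, h4, by omega⟩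

def zeroProg : Prog := .block [.const 0 0, .const 1 1]

theorem halts_zeroProg {L : ℕ} (hL : 0 < L) {s : State} :
    Halts L zeroProg s fun s' t => s'.reg 0 = 0 ∧ s'.reg 1 = 1 ∧ t ≤ 3 := by
  apply Halts.of_vc
  simp only [zeroProg, Prog.vc_block_cons, Prog.vc_block_nil, Prog.Vc]
  refine ⟨by positivity, Nat.one_lt_two_pow (by omega), ?_⟩
  simp

/-- If `m < n`, a connected graph is a tree and has no state with one harmless failure, so the
quadratic loop is skipped. -/
def evalProg : Prog := .block [
  denProg, prodProg, .arith .add 5 7 2,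
  .ite (.lt 1 0) .skip (.block [.const 4 0, addStatesProg]),
  .arith .add 0 5 2, .arith .add 1 6 2]

theorem prod_factor_eq {m : ℕ} {a : ℕ → ℕ → ℕ} {i : ℕ} (hi : m ≤ i) :
    ∏ j ∈ Finset.range m, factor a i j = ∏ j ∈ Finset.range m, a 2 j :=
  Finset.prod_congr rfl fun j hj => by
    rw [Finset.mem_range] at hj
    rw [factor, if_neg (by omega)]

theorem halts_evalProg {L n m : ℕ} {a : ℕ → ℕ → ℕ} (ha : Admissible L n m a) {s : State}
    (hs : s.Loaded n m a) (h4 : s.reg 4 = m) :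
    Halts L evalProg s fun s' t =>
      s'.reg 0 = ∏ j ∈ Finset.range m, a 2 j + (if m < n then 0 else oneDown n m a m) ∧
      s'.reg 1 = ∏ j ∈ Finset.range m, a 3 j ∧
      t ≤ 20 * m + 50 + (if m < n then 0 else 70 * (n + m + 1) * m) := by
  apply Halts.block_cons
  refine (halts_denProg ha hs).imp ?_
  rintro s₁ t₁ ⟨a1, c1, ht1⟩
  have l1 := hs.of_agree (by norm_num) a1
  apply Halts.block_cons
  refine (halts_prodProg ha l1).imp ?_
  rintro s₂ t₂ ⟨a2, c2, ht2⟩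
  have l2 := l1.of_agree (by norm_num) a2
  rw [a1.1 4 (by norm_num), h4, prod_factor_eq le_rfl] at c2
  have c2' := a2.1 6 (by norm_num)
  rw [c1] at c2'
  have hle : ∏ j ∈ Finset.range m, a 2 j ≤ ∏ j ∈ Finset.range m, a 3 j := by
    rw [← prod_factor_eq (le_refl m)]
    exact ha.prod_factor_le m le_rfl
  have hlt := ha.prod_den_lt le_rfl
  apply Halts.of_vc
  rw [Prog.vc_block_cons, Prog.Vc]
  simp only [Op.eval, l2.zero, c2, add_zero]
  refine ⟨by omega, ?_⟩
  have l3 : (s₂.setReg 5 (∏ j ∈ Finset.range m, a 2 j)).Loaded n m a :=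
    l2.of_agree (r := 4) le_rfl ((State.Agree.refl _ _ _).setReg (by norm_num))
  have l4 : ((s₂.setReg 5 (∏ j ∈ Finset.range m, a 2 j)).setReg 4 0).Loaded n m a :=
    l3.of_agree (r := 4) le_rfl ((State.Agree.refl _ _ _).setReg (by norm_num))
  simp only [Prog.vc_block_cons, Prog.vc_block_nil, Prog.Vc, Op.eval, Test.holds]
  constructor
  · intro hb
    rw [l3.m_eq, l3.n_eq] at hb
    simp [l2.zero, c2', hb]
    omega
  · intro hb
    rw [l3.m_eq, l3.n_eq] at hb
    refine ⟨by positivity, ?_⟩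
    refine (halts_addStatesProg ha l4 (by simp) (by simpa using hle)).imp ?_
    rintro s₃ t₃ ⟨l5, c5, c6, ht3⟩
    simp [c2'] at c5 c6
    have hod := ha.oneDown_le m
    have hpr := ha.prod_lt
    rw [Nat.succ_mul] at hpr
    simp [l5.zero, c5, c6, hb]
    omega

def searchEvalProg : Prog := .block [
  .arith .add 4 1 2, reachProg, .ite (.lt 12 0) zeroProg evalProg]

/-- The tests `m + 1 < n` and `n < m` come before any search. The first makes `n` at most `m + 1`,
so a bound in `n + m` becomes one in `m`, even with many isolated nodes. -/
def relProg : Prog := .block [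
  .const 3 1, .arith .add 9 1 3,
  .ite (.lt 9 0) zeroProg (.ite (.lt 0 1) zeroProg searchEvalProg)]

theorem halts_searchEvalProg {L n m : ℕ} {a : ℕ → ℕ → ℕ} (ha : Admissible L n m a) (hL : 0 < L)
    {s : State} (hs : s.Loaded n m a) :
    Halts L searchEvalProg s fun s' t =>
      (Spans n m a m →
        s'.reg 0 = ∏ j ∈ Finset.range m, a 2 j + (if m < n then 0 else oneDown n m a m) ∧
        s'.reg 1 = ∏ j ∈ Finset.range m, a 3 j ∧
        t ≤ 70 * (n + m + 2) + (if m < n then 0 else 70 * (n + m + 1) * m)) ∧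
      (¬ Spans n m a m → s'.reg 0 = 0 ∧ s'.reg 1 = 1 ∧ t ≤ 70 * (n + m + 2)) := by
  have hm := ha.m_lt
  have l1 : (s.setReg 4 m).Loaded n m a :=
    hs.of_agree (r := 4) le_rfl ((State.Agree.refl _ _ _).setReg (by norm_num))
  apply Halts.block_cons
  apply Halts.of_vc
  simp only [Prog.Vc, Op.eval, hs.zero, hs.m_eq, add_zero]
  refine ⟨by omega, ?_⟩
  apply Halts.block_cons
  refine (halts_reachProg' ha l1).imp ?_
  rintro s₂ t₂ ⟨a2, c2, ht2⟩
  have l2 := l1.of_agree (by norm_num) a2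
  rw [State.reg_setReg, if_pos rfl] at c2
  apply Halts.block_cons
  apply Halts.ite
  · intro hb
    rw [Test.holds, l2.n_eq, c2] at hb
    refine (halts_zeroProg hL).imp ?_
    rintro s₃ t₃ ⟨c3, c4, ht3⟩
    apply Halts.of_vc
    rw [Prog.vc_block_nil]
    exact ⟨fun h => absurd h hb, fun _ => ⟨c3, c4, by omega⟩⟩
  · intro hb
    rw [Test.holds, l2.n_eq, c2, not_not] at hb
    refine (halts_evalProg ha l2 (by simpa using a2.1 4 (by norm_num))).imp ?_
    rintro s₃ t₃ ⟨c3, c4, ht3⟩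
    apply Halts.of_vc
    rw [Prog.vc_block_nil]
    exact ⟨fun h => ⟨c3, c4, by omega⟩, fun h => absurd hb h⟩

theorem halts_relProg {L n m : ℕ} {a : ℕ → ℕ → ℕ} (ha : Admissible L n m a) (hL : 0 < L)
    {s : State} (h0 : s.reg 0 = n) (h1 : s.reg 1 = m) (h2 : s.reg 2 = 0)
    (harr : ∀ b < 4, s.arr b = a b) :
    Halts L relProg s fun s' t =>
      (n ≤ m + 1 → m ≤ n → Spans n m a m →
        s'.reg 0 = ∏ j ∈ Finset.range m, a 2 j + (if m < n then 0 else oneDown n m a m) ∧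
        s'.reg 1 = ∏ j ∈ Finset.range m, a 3 j ∧
        t ≤ 300 * (m + 1) + (if m < n then 0 else 300 * (m + 1) * m)) ∧
      (¬ (n ≤ m + 1 ∧ m ≤ n ∧ Spans n m a m) →
        s'.reg 0 = 0 ∧ s'.reg 1 = 1 ∧ t ≤ 300 * (m + 1)) := by
  have hm := ha.m_lt
  have l1 : ((s.setReg 3 1).setReg 9 (m + 1)).Loaded n m a :=
    ⟨by simp [h0], by simp [h1], by simp [h2], by simp, by simpa using harr⟩
  apply Halts.block_cons
  apply Halts.of_vc
  rw [Prog.Vc]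
  refine ⟨Nat.one_lt_two_pow (by omega), ?_⟩
  apply Halts.block_cons
  apply Halts.of_vc
  simp only [Prog.Vc, Op.eval, State.reg_setReg]
  simp only [if_true, h1, OfNat.one_ne_ofNat, if_false]
  refine ⟨by omega, ?_⟩
  apply Halts.block_cons
  apply Halts.ite
  · intro hb
    simp only [Test.holds, l1.n_eq, State.reg_setReg, if_true] at hb
    refine (halts_zeroProg hL).imp ?_
    rintro s₃ t₃ ⟨c3, c4, ht3⟩
    apply Halts.of_vc
    rw [Prog.vc_block_nil]
    exact ⟨fun h => absurd h (by omega), fun _ => ⟨c3, c4, by omega⟩⟩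
  intro hb
  simp only [Test.holds, l1.n_eq, State.reg_setReg, if_true, not_lt] at hb
  apply Halts.ite
  · intro hb'
    rw [Test.holds, l1.n_eq, l1.m_eq] at hb'
    refine (halts_zeroProg hL).imp ?_
    rintro s₃ t₃ ⟨c3, c4, ht3⟩
    apply Halts.of_vc
    rw [Prog.vc_block_nil]
    exact ⟨fun _ h => absurd h (by omega), fun _ => ⟨c3, c4, by omega⟩⟩
  intro hb'
  rw [Test.holds, l1.n_eq, l1.m_eq, not_lt] at hb'
  refine (halts_searchEvalProg ha hL l1).imp ?_
  rintro s₃ t₃ ⟨c3, c4⟩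
  apply Halts.of_vc
  rw [Prog.vc_block_nil]
  have hmul : 70 * (n + m + 1) * m ≤ 300 * (m + 1) * m :=
    Nat.mul_le_mul_right _ (by omega)
  refine ⟨fun _ _ h => ?_, fun h => ?_⟩
  · obtain ⟨c5, c6, ht⟩ := c3 h
    refine ⟨c5, c6, ?_⟩
    split_ifs at ht ⊢ <;> omega
  · obtain ⟨c5, c6, ht⟩ := c4 fun h' => h ⟨hb, hb', h'⟩
    exact ⟨c5, c6, by omega⟩

/-! ### Correctness of the program on networks -/

namespace Network

open SimpleGraph

variable (N : Network)

theorem arr_src (i : Fin N.m) : N.input.arr 0 i = N.src i := by simp [input]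
theorem arr_tgt (i : Fin N.m) : N.input.arr 1 i = N.tgt i := by simp [input]
theorem arr_num (i : Fin N.m) : N.input.arr 2 i = N.num i := by simp [input]
theorem arr_den (i : Fin N.m) : N.input.arr 3 i = N.den i := by simp [input]

theorem m_le_bitSize : N.m ≤ N.bitSize := by
  have : ∑ _i : Fin N.m, 1 ≤ ∑ i, ((N.src i : ℕ).size + (N.tgt i : ℕ).size + (N.num i).size +
      (N.den i).size) := Finset.sum_le_sum fun i _ => by
    have := Nat.size_pos.2 (N.den_pos i)
    omega
  simp only [Finset.sum_const, Finset.card_univ, Fintype.card_fin, smul_eq_mul, mul_one] at this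
  rw [bitSize]
  omega

theorem prod_den_le : ∏ i, N.den i ≤ 2 ^ ∑ i, (N.den i).size := by
  rw [← Finset.prod_pow_eq_pow_sum]
  exact Finset.prod_le_prod' fun i _ => (Nat.lt_size_self _).le

/-- The denominators and `m` are part of the input, so `(m + 1) * ∏ den` already fits into `bitSize`
digits; the two spare digits cover `2 * m + 1` and make the inequalities strict. -/
theorem admissible : Admissible (N.bitSize + 2) N.n N.m N.input.arr := by
  have hn : N.n < 2 ^ N.n.size := Nat.lt_size_self _
  have hm : N.m < 2 ^ N.m.size := Nat.lt_size_self _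
  have hb1 : 2 ^ N.n.size ≤ 2 ^ N.bitSize :=
    Nat.pow_le_pow_right (by norm_num) (by rw [bitSize]; omega)
  have hb2 : 2 ^ N.m.size ≤ 2 ^ N.bitSize :=
    Nat.pow_le_pow_right (by norm_num) (by rw [bitSize]; omega)
  have hpow : 2 ^ (N.bitSize + 2) = 4 * 2 ^ N.bitSize := by rw [pow_add]; ring
  refine ⟨N.n_pos, by omega, by omega, fun j hj => ?_, fun j hj => ?_, fun j hj => ?_,
    fun j hj => ?_, ?_⟩
  · rw [N.arr_src ⟨j, hj⟩]; exact (N.src ⟨j, hj⟩).2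
  · rw [N.arr_tgt ⟨j, hj⟩]; exact (N.tgt ⟨j, hj⟩).2
  · rw [N.arr_num ⟨j, hj⟩, N.arr_den ⟨j, hj⟩]; exact N.num_le_den _
  · rw [N.arr_den ⟨j, hj⟩]; exact N.den_pos _
  · rw [Finset.prod_range]
    simp only [arr_den]
    have h1 : (N.m + 1) * ∏ i, N.den i ≤ 2 ^ N.m.size * 2 ^ ∑ i, (N.den i).size :=
      Nat.mul_le_mul hm N.prod_den_le
    rw [← pow_add] at h1
    have h2 : ∑ i, (N.den i).size ≤ ∑ i, ((N.src i : ℕ).size + (N.tgt i : ℕ).size +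
        (N.num i).size + (N.den i).size) := Finset.sum_le_sum fun i _ => by omega
    have h3 : 2 ^ (N.m.size + ∑ i, (N.den i).size) ≤ 2 ^ N.bitSize :=
      Nat.pow_le_pow_right (by norm_num) (by rw [bitSize]; omega)
    have h4 : 0 < 2 ^ N.bitSize := by positivity
    omega

/-- The `i`-th link. -/
def link (i : Fin N.m) : Sym2 (Fin N.n) := s(N.src i, N.tgt i)

theorem link_inj : Function.Injective N.link := N.link_injective

theorem links_graph : links N.graph = Finset.univ.image N.link := by
  ext e
  simp only [mem_links, graph, edgeSet_fromEdgeSet, Set.mem_sdiff, Set.mem_range, Finset.mem_image,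
    Finset.mem_univ, true_and, link]
  refine ⟨fun h => h.1, fun h => ⟨h, ?_⟩⟩
  obtain ⟨i, rfl⟩ := h
  simpa using N.src_ne_tgt i

theorem card_links_graph : (links N.graph).card = N.m := by
  rw [links_graph, Finset.card_image_of_injective _ N.link_inj]
  simp

theorem prob_link (i : Fin N.m) : N.prob (N.link i) = (N.num i : ℝ) / N.den i := by
  classical
  have : (Finset.univ.filter fun j => s(N.src j, N.tgt j) = N.link i) = {i} := by
    ext j
    simp only [Finset.mem_filter, Finset.mem_univ, true_and, Finset.mem_singleton]
    exact N.link_inj.eq_iff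
  rw [prob]
  convert! Finset.sum_singleton _ i

/-- The search without the link `k` reaches all nodes iff the other links form a pathset. -/
theorem spans_iff (k : ℕ) (E : Finset (Sym2 (Fin N.n)))
    (hE : ∀ e, e ∈ E ↔ ∃ i : Fin N.m, (i : ℕ) ≠ k ∧ N.link i = e) :
    Spans N.n N.m N.input.arr k ↔ IsPathset E := by
  have hstep : ∀ x y : Fin N.n, (y : ℕ) ∈ nbrs (N.input.arr 0) (N.input.arr 1) k N.m x ↔
      (fromEdgeSet (E : Set (Sym2 (Fin N.n)))).Adj x y := by
    intro x y
    rw [mem_nbrs, fromEdgeSet_adj, Finset.mem_coe, hE]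
    constructor
    · rintro ⟨j, hj, hjk, h⟩
      rw [N.arr_src ⟨j, hj⟩, N.arr_tgt ⟨j, hj⟩] at h
      have hne := N.src_ne_tgt ⟨j, hj⟩
      simp only [Fin.val_inj] at h
      rcases h with ⟨rfl, rfl⟩ | ⟨rfl, rfl⟩
      · exact ⟨⟨⟨j, hj⟩, hjk, rfl⟩, hne⟩
      · exact ⟨⟨⟨j, hj⟩, hjk, Sym2.eq_swap⟩, hne.symm⟩
    · rintro ⟨⟨i, hik, hi⟩, -⟩
      refine ⟨i, i.2, hik, ?_⟩
      rw [N.arr_src, N.arr_tgt]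
      simp only [Fin.val_inj]
      exact (Sym2.eq_iff.1 hi).imp_right And.symm
  have hlt : ∀ (x y : ℕ), y ∈ nbrs (N.input.arr 0) (N.input.arr 1) k N.m x → y < N.n := by
    intro x y h
    rw [mem_nbrs] at h
    obtain ⟨j, hj, -, ⟨-, rfl⟩ | ⟨-, rfl⟩⟩ := h
    · exact N.admissible.tgt_lt j hj
    · exact N.admissible.src_lt j hj
  have hreach : ∀ v : Fin N.n, Relation.ReflTransGen
      (fun x y => y ∈ nbrs (N.input.arr 0) (N.input.arr 1) k N.m x) 0 (v : ℕ) ↔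
      (fromEdgeSet (E : Set (Sym2 (Fin N.n)))).Reachable ⟨0, N.n_pos⟩ v := by
    intro v
    constructor
    · intro h
      have : ∀ w : ℕ, Relation.ReflTransGen
          (fun x y => y ∈ nbrs (N.input.arr 0) (N.input.arr 1) k N.m x) 0 w → ∀ hw : w < N.n,
          (fromEdgeSet (E : Set (Sym2 (Fin N.n)))).Reachable ⟨0, N.n_pos⟩ ⟨w, hw⟩ := by
        intro w h
        induction h with
        | refl => exact fun _ => Reachable.refl _
        | @tail b c hb hbc ih =>
          intro hc
          have hbn : b < N.n := by
            rcases Relation.ReflTransGen.cases_tail hb with rfl | ⟨d, -, hd⟩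
            · exact N.n_pos
            · exact hlt _ _ hd
          exact (ih hbn).trans ((hstep ⟨b, hbn⟩ ⟨c, hc⟩).1 hbc).reachable
      exact this v h v.2
    · intro h
      refine mem_of_reachable (S := {v : Fin N.n | Relation.ReflTransGen
        (fun x y => y ∈ nbrs (N.input.arr 0) (N.input.arr 1) k N.m x) 0 (v : ℕ)}) ?_ h
        Relation.ReflTransGen.refl
      intro x y hxy hx
      exact Relation.ReflTransGen.tail hx ((hstep x y).2 hxy)
  rw [IsPathset, connected_iff_exists_forall_reachable]
  constructor
  · exact fun h => ⟨⟨0, N.n_pos⟩, fun v => (hreach v).1 (h v v.2)⟩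
  · rintro ⟨w, hw⟩ v hv
    exact (hreach ⟨v, hv⟩).2 ((hw _).symm.trans (hw _))

theorem spans_m_iff : Spans N.n N.m N.input.arr N.m ↔ N.graph.Connected := by
  rw [N.spans_iff N.m (links N.graph), isPathset_links]
  intro e
  rw [links_graph]
  simp only [Finset.mem_image, Finset.mem_univ, true_and]
  exact ⟨fun ⟨i, hi⟩ => ⟨i, i.2.ne, hi⟩, fun ⟨i, _, hi⟩ => ⟨i, hi⟩⟩

theorem spans_link_iff (i : Fin N.m) :
    Spans N.n N.m N.input.arr i ↔ IsPathset ((links N.graph).erase (N.link i)) := by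
  refine N.spans_iff i _ fun e => ?_
  rw [links_graph, Finset.mem_erase]
  simp only [Finset.mem_image, Finset.mem_univ, true_and, ne_eq, Fin.val_inj]
  constructor
  · rintro ⟨h, j, rfl⟩
    exact ⟨j, fun hj => h (hj ▸ rfl), rfl⟩
  · rintro ⟨j, hj, rfl⟩
    exact ⟨fun h => hj (N.link_inj h), j, rfl⟩

-- All states share the denominator `∏ den`; the factor `1 - num / den` of a failing link has
-- numerator `den - num`.
open scoped Classical in
theorem reliability_eq (hc : N.graph.Connected) (hmn : N.m ≤ N.n) :
    reliability N.graph N.prob =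
      ((∏ j ∈ Finset.range N.m, N.input.arr 2 j + oneDown N.n N.m N.input.arr N.m : ℕ) : ℝ) /
        (∏ j ∈ Finset.range N.m, N.input.arr 3 j : ℕ) := by
  have hden : ∀ i, (N.den i : ℝ) ≠ 0 := fun i => by exact_mod_cast (N.den_pos i).ne'
  have hrel : reliability N.graph N.prob = ∏ e ∈ links N.graph, N.prob e +
      ∑ e ∈ links N.graph with IsPathset ((links N.graph).erase e),
        (1 - N.prob e) * ∏ e' ∈ (links N.graph).erase e, N.prob e' := by
    convert! reliability_eq_of_card_le hc (by simpa [card_links_graph] using hmn) N.prob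
  rw [hrel, oneDown, Finset.sum_range, Finset.prod_range, Finset.prod_range]
  simp only [N.arr_num, N.arr_den, Nat.cast_add, Nat.cast_sum, Nat.cast_prod, add_div,
    Finset.sum_div]
  rw [Finset.sum_filter]
  have himg : ∀ f : Sym2 (Fin N.n) → ℝ, ∏ e ∈ links N.graph, f e = ∏ i, f (N.link i) := fun f => by
    rw [links_graph, Finset.prod_image N.link_inj.injOn]
  have himg' : ∀ f : Sym2 (Fin N.n) → ℝ, ∑ e ∈ links N.graph, f e = ∑ i, f (N.link i) := fun f => by
    rw [links_graph, Finset.sum_image N.link_inj.injOn]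
  rw [himg, himg']
  congr 1
  · simp only [prob_link, Finset.prod_div_distrib]
  · refine Finset.sum_congr rfl fun i _ => ?_
    rw [N.spans_link_iff i]
    by_cases h : IsPathset ((links N.graph).erase (N.link i))
    swap
    · simp [h]
    simp only [if_pos h]
    have herase : (links N.graph).erase (N.link i) = (Finset.univ.erase i).image N.link := by
      rw [links_graph, Finset.image_erase N.link_inj]
    rw [herase, Finset.prod_image N.link_inj.injOn, Finset.prod_range, Nat.cast_prod,
      ← Finset.prod_div_distrib, ← Finset.mul_prod_erase _ _ (Finset.mem_univ i), prob_link]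
    congr 1
    · rw [factor, if_pos rfl, N.arr_num, N.arr_den, Nat.cast_sub (N.num_le_den i)]
      rw [sub_div, div_self (hden i)]
    · refine Finset.prod_congr rfl fun j hj => ?_
      rw [prob_link, factor, if_neg (fun h => (Finset.mem_erase.1 hj).1 (Fin.ext h)), N.arr_num]

/-- With one link down, fewer than `n - 1` links remain, too few to connect `n` nodes. -/
theorem oneDown_eq_zero (h : N.m < N.n) : oneDown N.n N.m N.input.arr N.m = 0 := by
  classical
  rw [oneDown, Finset.sum_range]
  refine Finset.sum_eq_zero fun i _ => if_neg fun hs => ?_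
  have h1 := ((N.spans_link_iff i).1 hs).card_le
  rw [Finset.card_erase_of_mem (by
      rw [links_graph]
      exact Finset.mem_image_of_mem _ (Finset.mem_univ i)),
    card_links_graph, Nat.card_eq_fintype_card, Fintype.card_fin] at h1
  have := i.2
  omega

theorem exists_runs_relProg (hsep : IsSeparable N.graph) :
    ∃ (s : State) (t b : ℕ), Runs relProg N.input s t b ∧
      s.Outputs (reliability N.graph N.prob) ∧ b ≤ t * (3 * (N.bitSize + 2) + 1) ∧
      t ≤ 300 * (N.m + 1) ^ 2 ∧
      ((¬ N.graph.Connected ∨ N.graph.IsTree) → t ≤ 300 * (N.m + 1)) := by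
  have ha := N.admissible
  have hsmall : N.input.Small (N.bitSize + 2) := by
    have h1 := ha.n_lt
    have h2 := ha.m_lt
    have hpos : 0 < 2 ^ (N.bitSize + 2) := by positivity
    refine ⟨fun x => ?_, fun a i => ?_⟩
    · simp only [input]
      split <;> omega
    · by_cases hi : i < N.m
      · have hd : N.input.arr 3 i < 2 ^ (N.bitSize + 2) :=
          lt_of_le_of_lt (Finset.single_le_prod' (f := N.input.arr 3)
            (fun j hj => ha.den_pos j (Finset.mem_range.1 hj)) (Finset.mem_range.2 hi))
            (ha.prod_den_lt le_rfl)
        match a with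
        | 0 => exact (ha.src_lt i hi).trans h1
        | 1 => exact (ha.tgt_lt i hi).trans h1
        | 2 => exact (ha.le_den i hi).trans_lt hd
        | 3 => exact hd
        | _ + 4 => simp [input, hi]
      · simp [input, hi]
  obtain ⟨s, t, b, hrun, hb, -, h1, h2⟩ := halts_relProg ha (by omega) (s := N.input) rfl rfl rfl
    (fun _ _ => rfl) hsmall
  have hsq : 300 * (N.m + 1) ^ 2 = 300 * (N.m + 1) + 300 * (N.m + 1) * N.m := by ring
  refine ⟨s, t, b, hrun, ?_⟩
  rw [N.spans_m_iff] at h1 h2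
  by_cases hc : N.graph.Connected
  · have hle := hsep.card_links_le hc
    have hge := (isPathset_links.2 hc).card_le
    rw [card_links_graph, Nat.card_eq_fintype_card, Fintype.card_fin] at hle hge
    obtain ⟨c0, c1, ht⟩ := h1 hge hle hc
    refine ⟨⟨?_, ?_⟩, hb, ?_, ?_⟩
    · rw [c1]
      exact Finset.prod_pos fun j hj => ha.den_pos j (Finset.mem_range.1 hj)
    · rw [N.reliability_eq hc hle, c0, c1]
      split_ifs with hlt
      · rw [N.oneDown_eq_zero hlt]
      · rfl
    · split_ifs at ht <;> omega
    · rintro (h | h)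
      · exact absurd hc h
      · have := (isTree_iff_connected_and_card_links.1 h).2
        rw [card_links_graph, Nat.card_eq_fintype_card, Fintype.card_fin] at this
        rw [if_pos (by omega)] at ht
        omega
  · obtain ⟨c0, c1, ht⟩ := h2 fun h => hc h.2.2
    refine ⟨⟨by omega, ?_⟩, hb, by omega, fun _ => ht⟩
    rw [reliability_eq_zero hc, c0]
    simp

end Network

end SepRel

theorem mainTheorem2 :
    -- the four kinds of separable graphs, and the formulas
    (∀ {V : Type*} [Finite V] [Nonempty V] (G : SimpleGraph V), SepRel.IsSeparable G →
      ((¬ G.Connected) ∨ G.IsTree ∨ SepRel.IsElementaryCycle G ∨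
        ∃ (u : V) (c : G.Walk u u), SepRel.IsCycleWithArborescences G c) ∧
      ∀ p : Sym2 V → ℝ, (∀ e ∈ SepRel.links G, 0 ≤ p e ∧ p e ≤ 1) →
        (¬ G.Connected → SepRel.reliability G p = 0) ∧
        (G.IsTree → SepRel.reliability G p = ∏ e ∈ SepRel.links G, p e) ∧
        (SepRel.IsElementaryCycle G →
          SepRel.reliability G p = SepRel.cycleTerm (SepRel.links G) p) ∧
        (∀ (u : V) (c : G.Walk u u), SepRel.IsCycleWithArborescences G c →
          SepRel.reliability G p = SepRel.cycleTerm (SepRel.walkLinks c) p *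
            ∏ e ∈ SepRel.links (SepRel.pendantPart G c), p e)) ∧
    -- one program evaluates the reliability of all separable graphs, within a number of elementary
    -- operations that is linear or quadratic in the number of links, and in polynomial bit cost
    (∃ (P : SepRel.Prog) (C : ℕ) (q : Polynomial ℕ),
      ∀ N : SepRel.Network, SepRel.IsSeparable N.graph →
        ∃ (s : SepRel.State) (t b : ℕ), SepRel.Runs P N.input s t b ∧
          s.Outputs (SepRel.reliability N.graph N.prob) ∧
          b ≤ q.eval N.bitSize ∧
          t ≤ C * (N.m + 1) ^ 2 ∧
          ((¬ N.graph.Connected ∨ N.graph.IsTree) → t ≤ C * (N.m + 1))) := by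
  refine ⟨fun G hG => ⟨hG.classification, fun p _ => ⟨fun h => SepRel.reliability_eq_zero h p,
    fun h => SepRel.reliability_of_isTree h p,
    fun h => SepRel.reliability_of_isElementaryCycle h p,
    fun u c hc => SepRel.reliability_of_hanging hc.1 hc.2.2.1 hc.2.2.2 p⟩⟩,
    SepRel.relProg, 300,
    -- The number of operations times the cost `3 * L + 1` of one operation with `L = bitSize + 2`,
    -- using `m ≤ bitSize`.
    Polynomial.C 300 * (Polynomial.X + 1) ^ 2 * (3 * (Polynomial.X + 2) + 1), fun N hN => ?_⟩
  obtain ⟨s, t, b, h1, h2, h3, h4, h5⟩ := N.exists_runs_relProg hN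
  refine ⟨s, t, b, h1, h2, h3.trans ?_, h4, h5⟩
  have hm := N.m_le_bitSize
  simp only [Polynomial.eval_mul, Polynomial.eval_C, Polynomial.eval_pow, Polynomial.eval_add,
    Polynomial.eval_X, Polynomial.eval_one, Polynomial.eval_ofNat]
  refine Nat.mul_le_mul_right _ (h4.trans ?_)
  gcongr
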